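/- \textbf{Setting.} Consider $k$ dichotomous items and $m$ latent classes, with fixed real constants $q_{jir}, c_{ji}, v_{jr}, d_j$. For $\theta=(\lambda,\eta)\in\mathbb R^t\times\mathbb R^u$ put $$p_{ji}(\theta)=\frac{\exp(\sum_{r=1}^t q_{jir}\lambda_r+c_{ji})}{1+\exp(\sum_{r=1}^t q_{jir}\lambda_r+c_{ji})},\qquad w_j(\theta)=\frac{\exp(\sum_{r=1}^u v_{jr}\eta_r+d_j)}{\sum_{h=1}^m\exp(\sum_{r=1}^u v_{hr}\eta_r+d_h)},$$ and for each answer pattern $y\in\{0,1\}^k$ let $$p_y(\theta)=\sum_{j=1}^m w_j(\theta)\prod_{i=1}^k p_{ji}(\theta)^{y_i}(1-p_{ji}(\theta))^{1-y_i}$$ be its manifest probability; $p(\theta)=(p_y(\theta))_y\in\mathbb R^{2^k}$. Let $\Theta\subseteq\mathbb R^{t+u}$ be the parameter space and let the true parameter $\theta_0$ be an interior point of $\Theta$. Let $J=(\partial p_y(\theta_0)/\partial\theta_s)_{y,s}$ be the $2^k\times(t+u)$ Jacobian matrix at $\theta_0$, and $A=D_{p(\theta_0)}^{-1/2}J$,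 where $D_{p(\theta_0)}$ is the diagonal matrix with diagonal $p(\theta_0)$. Suppose that Birch's conditions hold: (i) $p_y(\theta_0)>0$ for all $y$; (ii) $p:\Theta\to\mathbb R^{2^k}$ is continuous, and it is totally differentiable at $\theta_0$; (iii) $J$ has rank $t+u$; (iv) the inverse mapping of $p$ is continuous at $p(\theta_0)$, i.e. for every neighbourhood $U$ of $\theta_0$ there is a neighbourhood $V$ of $p(\theta_0)$ such that $\theta\in\Theta$ and $p(\theta)\in V$ imply $\theta\in U$. Let $\phi$ be convex and twice continuously differentiable on $(0,\infty)$ with $\phi(1)=0$ and $\phi''(1)\neq 0$. Put $$D_\phi(a,b)=\sum_y b_y\,\phi(a_y/b_y)\in(-\infty,+\infty],$$ with $\phi(0)=\lim_{x\to0+}\phi(x)$, $0\,\phi(0/0)=0$ and $0\,\phi(a/0)=a\lim_{x\to\infty}\phi(x)/x$. Let $Y_1,Y_2,\dots$ be independent random answer patterns with $\Pr(Y_n=y)=p_y(\theta_0)$ for all $y$, and let $\hat p=\hat p^{(N)}$ be the vector of relative frequencies of the $2^k$ patterns among $Y_1,\dots,Y_N$. A minimum $\phi$-divergence estimator based on $N$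 observations is any random vector $\hat\theta_\phi=\hat\theta_\phi^{(N)}$ that almost surely minimizes $\theta\mapsto D_\phi(\hat p,p(\theta))$ over $\Theta$ whenever a minimizer exists (its value is arbitrary otherwise). \textbf{Theorem 3.} Under these assumptions, for every sequence of minimum $\phi$-divergence estimators, the estimated manifest probabilities satisfy, as $N\to\infty$, $$\sqrt N\,\bigl(p(\hat\theta_\phi)-p(\theta_0)\bigr)\longrightarrow\mathcal N\bigl(0,\;J\,(A^TA)^{-1}J^T\bigr)\quad\text{in law.}$$ -/

import Mathlib

open MeasureTheory ProbabilityTheory Filter Topology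
open scoped Matrix

noncomputable section

namespace LatentClass

/-- Answer patterns to `k` dichotomous items (`true` = right answer); there are `2 ^ k` of them. -/
abbrev Pattern (k : ℕ) : Type := Fin k → Bool

/-- Parameter vectors `θ = (λ, η)` with `λ ∈ ℝ^t` (indices `Sum.inl r`) and `η ∈ ℝ^u`
(indices `Sum.inr s`). -/
abbrev Param (t u : ℕ) : Type := EuclideanSpace ℝ (Fin t ⊕ Fin u)

/-- Real vectors with one coordinate for every answer pattern. -/
abbrev PatternVec (k : ℕ) : Type := EuclideanSpace ℝ (Pattern k)

/-- The fixed constants of a linear-logistic latent class model for `k` binary items with `m`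
classes and parameters in `ℝ^t × ℝ^u`. -/
structure Model (k m t u : ℕ) where
  /-- the weights `q_{jir}` -/
  q : Fin m → Fin k → Fin t → ℝ
  /-- the constants `c_{ji}` -/
  c : Fin m → Fin k → ℝ
  /-- the weights `v_{jr}` -/
  v : Fin m → Fin u → ℝ
  /-- the constants `d_j` -/
  d : Fin m → ℝ

namespace Model

variable {k m t u : ℕ} (M : Model k m t u)

/-- `x_{ji} = ∑_r q_{jir} λ_r + c_{ji}`. -/
def itemLogit (θ : Param t u) (j : Fin m) (i : Fin k) : ℝ :=
  (∑ r, M.q j i r * θ (Sum.inl r)) + M.c j i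

/-- `p_{ji} = exp x_{ji} / (1 + exp x_{ji})`: probability of a right answer to item `i` for a
person in class `j`. -/
def itemProb (θ : Param t u) (j : Fin m) (i : Fin k) : ℝ :=
  Real.exp (M.itemLogit θ j i) / (1 + Real.exp (M.itemLogit θ j i))

/-- `z_j = ∑_r v_{jr} η_r + d_j`. -/
def classLogit (θ : Param t u) (j : Fin m) : ℝ :=
  (∑ r, M.v j r * θ (Sum.inr r)) + M.d j

/-- `w_j = exp z_j / ∑_h exp z_h`: relative size of class `j`. -/
def classWeight (θ : Param t u) (j : Fin m) : ℝ :=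
  Real.exp (M.classLogit θ j) / ∑ h, Real.exp (M.classLogit θ h)

/-- Probability of the pattern `y` in class `j`: the answers are independent within a class. -/
def condProb (θ : Param t u) (j : Fin m) (y : Pattern k) : ℝ :=
  ∏ i, if y i then M.itemProb θ j i else 1 - M.itemProb θ j i

/-- The vector `p(θ)` of manifest probabilities. -/
def manifest (θ : Param t u) : PatternVec k :=
  WithLp.toLp 2 fun y => ∑ j, M.classWeight θ j * M.condProb θ j y

/-- The Jacobian matrix `J(θ)`, whose `(y, s)` entry is `∂p_y(θ)/∂θ_s`
(`2 ^ k` rows, `t + u` columns). -/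
def jacobian (θ : Param t u) : Matrix (Pattern k) (Fin t ⊕ Fin u) ℝ :=
  Matrix.of fun y s => fderiv ℝ (fun θ' => M.manifest θ' y) θ (EuclideanSpace.single s 1)

/-- `A(θ) = D_{p(θ)}^{-1/2} J(θ)`. -/
def scaledJacobian (θ : Param t u) : Matrix (Pattern k) (Fin t ⊕ Fin u) ℝ :=
  Matrix.diagonal (fun y => (√(M.manifest θ y))⁻¹) * M.jacobian θ

/-- Birch's conditions at the point `θ₀` for the model with parameter space `Θ`. -/
structure Birch (Θ : Set (Param t u)) (θ₀ : Param t u) : Prop where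
  /-- all the manifest probabilities at `θ₀` are positive -/
  pos : ∀ y, 0 < M.manifest θ₀ y
  /-- `p` is continuous on `Θ` -/
  cont : ContinuousOn M.manifest Θ
  /-- `p` is totally differentiable at `θ₀` -/
  diff : DifferentiableAt ℝ M.manifest θ₀
  /-- the Jacobian matrix at `θ₀` has full column rank -/
  rank_eq : (M.jacobian θ₀).rank = t + u
  /-- the inverse mapping of `p : Θ → p(Θ)` is continuous at `p(θ₀)`, with value `θ₀` there
  (injectivity of `p` away from `p(θ₀)` is not demanded, so that the inverse may be multivalued
  at other points) -/
  inv_cont : ∀ U ∈ 𝓝 θ₀, ∃ V ∈ 𝓝 (M.manifest θ₀), ∀ θ ∈ Θ, M.manifest θ ∈ V → θ ∈ U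

end Model

/-- The class of functions that generate divergences: `φ` is convex on `(0, ∞)` and `φ(1) = 0`.
Only the values of `φ` on `(0, ∞)` matter. -/
structure IsDivergenceFunction (φ : ℝ → ℝ) : Prop where
  convexOn : ConvexOn ℝ (Set.Ioi 0) φ
  map_one : φ 1 = 0

/-- `φ(x)` for `x ≥ 0`, where `φ(0)` is `lim_{x → 0+} φ(x)`, which may be `+∞`
(the limit exists for convex `φ` and is then equal to the limes superior). -/
def phiExt (φ : ℝ → ℝ) (x : ℝ) : EReal :=
  if 0 < x then (φ x : EReal) else limsup (fun z : ℝ => (φ z : EReal)) (𝓝[>] 0)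

/-- The summand `b φ(a / b)` for `a, b ≥ 0`, with the conventions `0 φ(0 / 0) = 0` and
`0 φ(a / 0) = a lim_{x → ∞} φ(x) / x`. -/
def phiTerm (φ : ℝ → ℝ) (a b : ℝ) : EReal :=
  if b = 0 then
    if a = 0 then 0 else (a : EReal) * limsup (fun z : ℝ => ((φ z / z : ℝ) : EReal)) atTop
  else (b : EReal) * phiExt φ (a / b)

/-- The `φ`-divergence `D_φ(a, b) = ∑_y b_y φ(a_y / b_y)`. -/
def phiDivergence {k : ℕ} (φ : ℝ → ℝ) (a b : PatternVec k) : EReal :=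
  ∑ y, phiTerm φ (a y) (b y)

/-- The set of the minimizers over `θ ∈ Θ` of `D_φ(a, p(θ))`. -/
def Model.argminPhi {k m t u : ℕ} (M : Model k m t u) (φ : ℝ → ℝ) (Θ : Set (Param t u))
    (a : PatternVec k) : Set (Param t u) :=
  {θ | θ ∈ Θ ∧ ∀ θ' ∈ Θ, phiDivergence φ a (M.manifest θ) ≤ phiDivergence φ a (M.manifest θ')}

/-- The vector of relative frequencies of the answer patterns among the first `N` observations. -/
def empirical {k : ℕ} {Ω : Type*} (Y : ℕ → Ω → Pattern k) (N : ℕ) (ω : Ω) : PatternVec k :=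
  WithLp.toLp 2 fun y => (((Finset.range N).filter fun n => Y n ω = y).card : ℝ) / (N : ℝ)

/-- The observations are independent, and every one of them has the pattern `y` with the manifest
probability `p_y(θ₀)`. -/
structure Model.IsSample {k m t u : ℕ} (M : Model k m t u) (θ₀ : Param t u)
    {Ω : Type*} [MeasurableSpace Ω] (P : Measure Ω) (Y : ℕ → Ω → Pattern k) : Prop where
  measurable : ∀ n, Measurable (Y n)
  indep : iIndepFun Y P
  law : ∀ n y, P.real (Y n ⁻¹' {y}) = M.manifest θ₀ y

/-- `est N` is a minimum `φ`-divergence estimator of `θ` based on the first `N` observations: a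
random vector which almost surely minimizes `D_φ(p̂, p(θ))` over `θ ∈ Θ` whenever there is a
minimizer at all. (For some samples there may be none, for instance when `Θ` is not compact; on
these the value of `est N` is arbitrary.) -/
structure Model.IsMinPhiEstimator {k m t u : ℕ} (M : Model k m t u) (φ : ℝ → ℝ)
    (Θ : Set (Param t u)) {Ω : Type*} [MeasurableSpace Ω] (P : Measure Ω)
    (Y : ℕ → Ω → Pattern k) (est : ℕ → Ω → Param t u) : Prop where
  aemeasurable : ∀ N, AEMeasurable (est N) P
  mem_argmin : ∀ N, 0 < N → ∀ᵐ ω ∂P, (M.argminPhi φ Θ (empirical Y N ω)).Nonempty →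
    est N ω ∈ M.argminPhi φ Θ (empirical Y N ω)

end LatentClass

end

/-! Write `p₀ = p(θ₀)`, `D = D_{p₀}` and `Π = J (AᵀA)⁻¹ Jᵀ D⁻¹`, the projection onto the range of
`J` that is orthogonal for the inner product with matrix `D⁻¹`. The core is deterministic: as a
probability vector `a` tends to `p₀`, every minimizer `θ` of `D_φ(a, p(θ))` satisfies `p(θ) - p₀ = Π
(a - p₀) + o(‖a - p₀‖)` (`manifest_minimizer_isLittleO`). Near the diagonal, `D_φ(a, b)` is
`φ''(1)/2 · ‖D^{-1/2}(a - b)‖²` up to a relative error `o(1)` (`sum_centered_isLittleO`), so the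
minimization is asymptotically a least squares problem on the tangent space. Comparing the minimizer
with an explicit competitor whose manifest vector is `p₀ + Π (a - p₀)` to first order, Pythagoras
forces the two to agree up to `o(‖a - p₀‖)` (`isLittleO_sub_of_le`). No estimating equation is
differentiated, so total differentiability at `θ₀` is enough.

Consistency comes from convexity: a small divergence forces closeness
(`exists_norm_sub_lt_of_sum_centered_lt`), and continuity of the inverse carries this over to `θ`.
The same facts give existence of minimizers for `a` near `p₀`, so the arbitrary values of an
estimator are used with vanishing probability only.

For `a = p̂`, Chebyshev's inequality bounds `√N ‖p̂ - p₀‖` in probability, hence the remainder is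
negligible, and Slutsky's theorem reduces the claim to the central limit theorem for `√N Π (p̂ -
p₀)`. As `Π p₀ = 0`, the multinomial covariance `D - p₀ p₀ᵀ` contributes `Π D Πᵀ = J (AᵀA)⁻¹ Jᵀ`. -/

noncomputable section

namespace LatentClass

open Asymptotics

/-- `φ` minus its tangent line at `1`; it generates the same divergence on probability vectors. -/
def centered (φ : ℝ → ℝ) (x : ℝ) : ℝ := φ x - deriv φ 1 * (x - 1)

/-! ### Convexity and Taylor estimates for the generator at `1`. -/

section Scalar

variable {φ : ℝ → ℝ}

theorem centered_isLittleO (h1 : φ 1 = 0) (hs : ContDiffOn ℝ 2 φ (Set.Ioi 0)) :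
    (fun x => centered φ x - iteratedDeriv 2 φ 1 / 2 * (x - 1) ^ 2) =o[𝓝 1]
      fun x => (x - 1) ^ 2 := by
  have h01 : (1 : ℝ) ∈ Set.Ioi (0 : ℝ) := by simp
  have h := taylor_isLittleO (convex_Ioi (0 : ℝ)) h01 (n := 2) hs
  rw [isOpen_Ioi.nhdsWithin_eq h01] at h
  refine h.congr' (Eventually.of_forall fun x => ?_) (Eventually.of_forall fun x => rfl)
  have e1 : iteratedDerivWithin 1 φ (Set.Ioi 0) 1 = deriv φ 1 := by
    rw [iteratedDerivWithin_one, derivWithin_of_isOpen isOpen_Ioi h01]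
  have e2 : iteratedDerivWithin 2 φ (Set.Ioi 0) 1 = iteratedDeriv 2 φ 1 :=
    iteratedDerivWithin_of_isOpen isOpen_Ioi h01
  simp only [taylorWithinEval_succ, taylor_within_zero_eval, h1, e1, e2, centered, smul_eq_mul,
    zero_add]
  norm_num [Nat.factorial]
  ring

theorem differentiableAt_one (hs : ContDiffOn ℝ 2 φ (Set.Ioi 0)) : DifferentiableAt ℝ φ 1 :=
  (hs.contDiffAt (Ioi_mem_nhds one_pos)).differentiableAt (by norm_num)

theorem centered_nonneg (hφ : IsDivergenceFunction φ) (hd : DifferentiableAt ℝ φ 1) {x : ℝ}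
    (hx : 0 < x) : 0 ≤ centered φ x := by
  have h01 : (1 : ℝ) ∈ Set.Ioi (0 : ℝ) := by simp
  have h1 := hφ.map_one
  unfold centered
  rcases lt_trichotomy x 1 with h | rfl | h
  · have := hφ.convexOn.slope_le_deriv (x := x) hx h01 h hd
    rw [slope_def_field, div_le_iff₀ (by linarith)] at this
    linarith
  · simp [h1]
  · have := hφ.convexOn.deriv_le_slope h01 (y := x) hx h hd
    rw [slope_def_field, le_div_iff₀ (by linarith)] at this
    linarith

/-- A negative value would, by the quadratic expansion, push `centered φ` below zero just to the
right of `1`, against convexity. -/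
theorem iteratedDeriv_two_pos (hφ : IsDivergenceFunction φ)
    (hs : ContDiffOn ℝ 2 φ (Set.Ioi 0)) (hne : iteratedDeriv 2 φ 1 ≠ 0) :
    0 < iteratedDeriv 2 φ 1 := by
  refine lt_of_le_of_ne (not_lt.1 fun hneg => ?_) hne.symm
  set κ := iteratedDeriv 2 φ 1
  have h := (centered_isLittleO hφ.map_one hs).def (c := -κ / 4) (by linarith)
  have h' : ∀ᶠ x in 𝓝[>] (1 : ℝ), False := by
    filter_upwards [nhdsWithin_le_nhds h, self_mem_nhdsWithin] with x hx h1x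
    have h1x : 1 < x := h1x
    have hp := centered_nonneg hφ (differentiableAt_one hs) (by linarith : 0 < x)
    rw [Real.norm_eq_abs, Real.norm_eq_abs, abs_of_nonneg (sq_nonneg (x - 1))] at hx
    have hx2 : 0 < (x - 1) ^ 2 := by have : 0 < x - 1 := by linarith
                                     positivity
    have := le_of_abs_le hx
    nlinarith
  obtain ⟨_, h''⟩ := h'.exists
  exact h''

theorem centered_convexOn (hφ : IsDivergenceFunction φ) :
    ConvexOn ℝ (Set.Ioi 0) (centered φ) := by
  refine ⟨convex_Ioi 0, fun x hx y hy a b ha hb hab => ?_⟩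
  have := hφ.convexOn.2 hx hy ha hb hab
  simp only [centered, smul_eq_mul] at this ⊢
  have hb' : b = 1 - a := by linarith
  subst hb'
  linarith

/-- A generator of a divergence with positive second derivative at `1` exceeds its tangent there
by at least a multiple of the Huber function. -/
theorem exists_mul_min_le_centered (hφ : IsDivergenceFunction φ)
    (hs : ContDiffOn ℝ 2 φ (Set.Ioi 0)) (hne : iteratedDeriv 2 φ 1 ≠ 0) :
    ∃ r > 0, ∃ c > 0, ∀ x, 0 < x → c * min (r * |x - 1|) (|x - 1| ^ 2) ≤ centered φ x := by
  have hκ := iteratedDeriv_two_pos hφ hs hne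
  set κ := iteratedDeriv 2 φ 1 with hκ_def
  have h := (centered_isLittleO hφ.map_one hs).def (c := κ / 4) (by linarith)
  obtain ⟨ρ, hρ, hball⟩ := Metric.eventually_nhds_iff.1 h
  obtain ⟨r, hr0, hr⟩ : ∃ r, 0 < r ∧ r < min ρ 1 := exists_between (lt_min hρ one_pos)
  have near : ∀ z, |z - 1| ≤ r → κ / 4 * |z - 1| ^ 2 ≤ centered φ z := fun z hz => by
    have := hball (y := z) (by rw [Real.dist_eq]; exact hz.trans_lt (hr.trans_le (min_le_left _ _)))
    rw [Real.norm_eq_abs, Real.norm_eq_abs, abs_of_nonneg (sq_nonneg (z - 1)), ← hκ_def] at this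
    have := neg_le_of_abs_le this
    rw [sq_abs]
    linarith
  refine ⟨r, hr0, κ / 4, by linarith, fun x hx => ?_⟩
  rcases le_or_gt |x - 1| r with hxr | hxr
  · exact (mul_le_mul_of_nonneg_left (min_le_right _ _) (by linarith)).trans (near x hxr)
  · refine (mul_le_mul_of_nonneg_left (min_le_left _ _) (by linarith)).trans ?_
    have hpos : 0 < |x - 1| := hr0.trans hxr
    -- The point `1 - s + s * x` of the segment from `1` to `x` is at distance exactly `r` from `1`.
    -- Since `centered φ` vanishes at `1`, convexity propagates the quadratic bound there to linear
    -- growth beyond.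
    set s := r / |x - 1| with hs_def
    have hs0 : 0 < s := by positivity
    have hs1 : s ≤ 1 := (div_le_one hpos).2 hxr.le
    have hconv := (centered_convexOn hφ).2 (show (1 : ℝ) ∈ Set.Ioi 0 by simp)
      (show x ∈ Set.Ioi 0 from hx) (show 0 ≤ 1 - s by linarith) hs0.le (by ring)
    have h1 : centered φ 1 = 0 := by simp [centered, hφ.map_one]
    simp only [smul_eq_mul, h1, mul_zero, zero_add, mul_one] at hconv
    have hz : |(1 - s + s * x) - 1| = r := by
      rw [show (1 - s + s * x) - 1 = s * (x - 1) by ring, abs_mul, abs_of_pos hs0, hs_def,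
        div_mul_cancel₀ _ hpos.ne']
    have := (near _ hz.le).trans hconv
    rw [hz] at this
    have hsr : s * |x - 1| = r := div_mul_cancel₀ _ hpos.ne'
    have : s * (κ / 4 * (r * |x - 1|)) ≤ s * centered φ x := by
      calc s * (κ / 4 * (r * |x - 1|)) = κ / 4 * r * (s * |x - 1|) := by ring
        _ = κ / 4 * r ^ 2 := by rw [hsr]; ring
        _ ≤ _ := this
    exact le_of_mul_le_mul_left this hs0

end Scalar

/-! ### Divergences near the diagonal and away from it. -/

section Divergence

variable {φ : ℝ → ℝ} {ι : Type*} [Fintype ι]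

/-- There are two errors: Taylor's remainder at `x.1 / x.2 → 1` (`hA`), and freezing the denominator
`x.2` at its limit `q` (`hB`). -/
theorem mul_centered_div_isLittleO (h1 : φ 1 = 0) (hs : ContDiffOn ℝ 2 φ (Set.Ioi 0)) {q : ℝ}
    (hq : 0 < q) :
    (fun x : ℝ × ℝ => x.2 * centered φ (x.1 / x.2)
        - iteratedDeriv 2 φ 1 / 2 * ((x.1 - x.2) ^ 2 / q))
      =o[𝓝 (q, q)] fun x => (x.1 - x.2) ^ 2 := by
  set κ := iteratedDeriv 2 φ 1 with hκ
  have hfst : Tendsto (fun x : ℝ × ℝ => x.1) (𝓝 (q, q)) (𝓝 q) := continuous_fst.tendsto _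
  have hsnd : Tendsto (fun x : ℝ × ℝ => x.2) (𝓝 (q, q)) (𝓝 q) := continuous_snd.tendsto _
  have hdiv : Tendsto (fun x : ℝ × ℝ => x.1 / x.2) (𝓝 (q, q)) (𝓝 1) := by
    have h := hfst.div hsnd hq.ne'
    rwa [div_self hq.ne'] at h
  have hpos : ∀ᶠ x : ℝ × ℝ in 𝓝 (q, q), 0 < x.2 := hsnd.eventually (lt_mem_nhds hq)
  have hA : (fun x : ℝ × ℝ => x.2 * (centered φ (x.1 / x.2) - κ / 2 * (x.1 / x.2 - 1) ^ 2))
      =o[𝓝 (q, q)] fun x => (x.1 - x.2) ^ 2 := by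
    have hb : (fun x : ℝ × ℝ => x.2⁻¹) =O[𝓝 (q, q)] fun _ => (1 : ℝ) :=
      (hsnd.inv₀ hq.ne').isBigO_one ℝ
    have := ((centered_isLittleO h1 hs).comp_tendsto hdiv)
    have h2 := ((isBigO_refl (fun x : ℝ × ℝ => x.2) (𝓝 (q, q))).mul_isLittleO this)
    refine h2.trans_isBigO ?_
    have h3 := (isBigO_refl (fun x : ℝ × ℝ => (x.1 - x.2) ^ 2) (𝓝 (q, q))).mul hb
    refine (h3.congr' ?_ (Eventually.of_forall fun x => mul_one _))
    filter_upwards [hpos] with x hx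
    simp only [Function.comp]
    field_simp
  have hB : (fun x : ℝ × ℝ => κ / 2 * (x.2⁻¹ - q⁻¹) * (x.1 - x.2) ^ 2)
      =o[𝓝 (q, q)] fun x => (x.1 - x.2) ^ 2 := by
    have ht : Tendsto (fun x : ℝ × ℝ => κ / 2 * (x.2⁻¹ - q⁻¹)) (𝓝 (q, q)) (𝓝 0) := by
      simpa using ((hsnd.inv₀ hq.ne').sub_const q⁻¹).const_mul (κ / 2)
    simpa using ((isLittleO_one_iff ℝ).2 ht).mul_isBigO
      (isBigO_refl (fun x : ℝ × ℝ => (x.1 - x.2) ^ 2) (𝓝 (q, q)))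
  refine (hA.add hB).congr' ?_ EventuallyEq.rfl
  filter_upwards [hpos] with x hx
  field_simp
  ring

/-- Multiplication by `D_p^{-1/2}`. -/
def invSqrtScale [DecidableEq ι] (p : EuclideanSpace ℝ ι) :
    EuclideanSpace ℝ ι →L[ℝ] EuclideanSpace ℝ ι :=
  Matrix.toEuclideanCLM (𝕜 := ℝ) (Matrix.diagonal fun y => (√(p y))⁻¹)

theorem invSqrtScale_apply [DecidableEq ι] (p x : EuclideanSpace ℝ ι) (y : ι) :
    invSqrtScale p x y = (√(p y))⁻¹ * x y := by
  simp [invSqrtScale, Matrix.ofLp_toEuclideanCLM, Matrix.mulVec_diagonal]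

theorem norm_invSqrtScale_sq [DecidableEq ι] {p : EuclideanSpace ℝ ι} (hp : ∀ y, 0 < p y)
    (x : EuclideanSpace ℝ ι) : ‖invSqrtScale p x‖ ^ 2 = ∑ y, x y ^ 2 / p y := by
  rw [EuclideanSpace.norm_sq_eq]
  refine Finset.sum_congr rfl fun y _ => ?_
  rw [invSqrtScale_apply, Real.norm_eq_abs, sq_abs, mul_pow, inv_pow, Real.sq_sqrt (hp y).le]
  ring

/-- Second order expansion of a divergence at the diagonal. -/
theorem sum_centered_isLittleO [DecidableEq ι] (h1 : φ 1 = 0)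
    (hs : ContDiffOn ℝ 2 φ (Set.Ioi 0)) {p : EuclideanSpace ℝ ι} (hp : ∀ y, 0 < p y) :
    (fun x : EuclideanSpace ℝ ι × EuclideanSpace ℝ ι =>
        (∑ y, x.2 y * centered φ (x.1 y / x.2 y))
          - iteratedDeriv 2 φ 1 / 2 * ‖invSqrtScale p (x.1 - x.2)‖ ^ 2)
      =o[𝓝 (p, p)] fun x => ‖invSqrtScale p (x.1 - x.2)‖ ^ 2 := by
  simp only [norm_invSqrtScale_sq hp, Finset.mul_sum, ← Finset.sum_sub_distrib]
  have key : ∀ y, (fun x : EuclideanSpace ℝ ι × EuclideanSpace ℝ ι =>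
      x.2 y * centered φ (x.1 y / x.2 y)
        - iteratedDeriv 2 φ 1 / 2 * ((x.1 - x.2) y ^ 2 / p y))
      =o[𝓝 (p, p)] fun x => ∑ z, (x.1 - x.2) z ^ 2 / p z := by
    intro y
    have ht : Tendsto (fun x : EuclideanSpace ℝ ι × EuclideanSpace ℝ ι => (x.1 y, x.2 y))
        (𝓝 (p, p)) (𝓝 (p y, p y)) := by
      have : Continuous fun x : EuclideanSpace ℝ ι × EuclideanSpace ℝ ι => (x.1 y, x.2 y) := by
        fun_prop
      exact this.tendsto (p, p)
    have := (mul_centered_div_isLittleO h1 hs (hp y)).comp_tendsto ht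
    refine (this.congr_left fun x => ?_).trans_isBigO ?_
    · simp
    · refine IsBigO.of_bound (p y) (Eventually.of_forall fun x => ?_)
      have hnn : ∀ z, 0 ≤ (x.1 - x.2) z ^ 2 / p z := fun z => div_nonneg (sq_nonneg _) (hp z).le
      rw [Real.norm_of_nonneg (Finset.sum_nonneg fun z _ => hnn z)]
      simp only [Function.comp, norm_pow, Real.norm_eq_abs, sq_abs]
      have := Finset.single_le_sum (fun z _ => hnn z) (Finset.mem_univ y)
      calc (x.1 y - x.2 y) ^ 2 = p y * ((x.1 - x.2) y ^ 2 / p y) := by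
            have := (hp y).ne'
            simp; field_simp
        _ ≤ _ := mul_le_mul_of_nonneg_left this (hp y).le
  exact IsLittleO.fun_sum fun y _ => key y

theorem norm_le_sum_abs (x : EuclideanSpace ℝ ι) : ‖x‖ ≤ ∑ y, |x y| := by
  refine abs_le_of_sq_le_sq' ?_ (Finset.sum_nonneg fun _ _ => abs_nonneg _) |>.2
  rw [EuclideanSpace.norm_sq_eq]
  exact Finset.sum_sq_le_sq_sum_of_nonneg fun _ _ => abs_nonneg _

theorem mul_centered_le_sum (hφ : IsDivergenceFunction φ) (hs : ContDiffOn ℝ 2 φ (Set.Ioi 0))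
    {a b : EuclideanSpace ℝ ι} (ha : ∀ y, 0 < a y) (hb : ∀ y, 0 < b y) (y : ι) :
    b y * centered φ (a y / b y) ≤ ∑ y, b y * centered φ (a y / b y) :=
  Finset.single_le_sum (f := fun y => b y * centered φ (a y / b y))
    (fun z _ => mul_nonneg (hb z).le
      (centered_nonneg hφ (differentiableAt_one hs) (div_pos (ha z) (hb z)))) (Finset.mem_univ y)

/-- Probability vectors with a small divergence are close to each other. -/
theorem exists_norm_sub_lt_of_sum_centered_lt (hφ : IsDivergenceFunction φ)
    (hs : ContDiffOn ℝ 2 φ (Set.Ioi 0)) (hne : iteratedDeriv 2 φ 1 ≠ 0) {ε : ℝ} (hε : 0 < ε) :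
    ∃ η > 0, ∀ a b : EuclideanSpace ℝ ι, (∀ y, 0 < a y) → (∀ y, 0 < b y) → ∑ y, b y = 1 →
      ∑ y, b y * centered φ (a y / b y) < η → ‖a - b‖ < ε := by
  obtain ⟨r, hr, c, hc, hlow⟩ := exists_mul_min_le_centered hφ hs hne
  -- The `+ 1` keeps `δ` meaningful for empty `ι` and makes the final inequality strict.
  set δ := ε / (Fintype.card ι + 1) with hδ_def
  have hδ : 0 < δ := by positivity
  refine ⟨c * min (r * δ) (δ ^ 2), by positivity, fun a b ha hb hb1 hlt => ?_⟩
  have hcoord : ∀ y, |(a - b) y| ≤ δ := fun y => by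
    by_contra hcon
    have hgt : δ < |a y - b y| := by simpa using not_le.1 hcon
    have hble : b y ≤ 1 := hb1 ▸ Finset.single_le_sum (fun z _ => (hb z).le) (Finset.mem_univ y)
    have hby := hb y
    have h1 := mul_centered_le_sum hφ hs ha hb y
    have h2 := mul_le_mul_of_nonneg_left (hlow _ (div_pos (ha y) hby)) hby.le
    have h3 : |a y / b y - 1| = |a y - b y| / b y := by
      rw [div_sub_one hby.ne', abs_div, abs_of_pos hby]
    -- Multiplication by `b y` turns the linear branch into `r * |a y - b y|` and the quadratic one
    -- into `|a y - b y| ^ 2 / b y`; the latter is at least `δ ^ 2` because `b y ≤ 1`.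
    have h4 : min (r * δ) (δ ^ 2) ≤ b y * min (r * |a y / b y - 1|) (|a y / b y - 1| ^ 2) := by
      rw [h3, mul_min_of_nonneg _ _ hby.le]
      refine min_le_min ?_ ?_
      · rw [show b y * (r * (|a y - b y| / b y)) = r * |a y - b y| by field_simp]
        gcongr
      · rw [show b y * (|a y - b y| / b y) ^ 2 = |a y - b y| ^ 2 / b y by field_simp,
          le_div_iff₀ hby]
        calc δ ^ 2 * b y ≤ δ ^ 2 * 1 := by gcongr
          _ ≤ |a y - b y| ^ 2 := by rw [mul_one]; gcongr
    have h5 := mul_le_mul_of_nonneg_left h4 hc.le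
    linarith
  calc ‖a - b‖ ≤ ∑ y, |(a - b) y| := norm_le_sum_abs _
    _ ≤ ∑ _y : ι, δ := Finset.sum_le_sum fun y _ => hcoord y
    _ = Fintype.card ι * δ := by simp
    _ < (Fintype.card ι + 1) * δ := by nlinarith
    _ = ε := by rw [hδ_def]; field_simp

end Divergence

/-- The tangent line contributes a multiple of `∑ (a y - b y) = 0`, and positivity keeps the
conventions at `0` and `∞` out of play. -/
theorem phiDivergence_eq_coe {k : ℕ} {φ : ℝ → ℝ} {a b : PatternVec k}
    (ha : ∀ y, 0 < a y) (hb : ∀ y, 0 < b y) (hab : ∑ y, a y = ∑ y, b y) :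
    phiDivergence φ a b = ((∑ y, b y * centered φ (a y / b y) : ℝ) : EReal) := by
  have h : ∑ y, b y * centered φ (a y / b y) = ∑ y, b y * φ (a y / b y) := by
    rw [← sub_eq_zero, ← Finset.sum_sub_distrib]
    calc _ = ∑ y, (-deriv φ 1) * (a y - b y) := Finset.sum_congr rfl fun y _ => by
          have := (hb y).ne'
          simp only [centered]; field_simp; ring
      _ = 0 := by rw [← Finset.mul_sum, Finset.sum_sub_distrib, hab]; simp
  have hsum : ((∑ y, b y * φ (a y / b y) : ℝ) : EReal) = ∑ y, ((b y * φ (a y / b y) : ℝ) : EReal) :=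
    map_sum (⟨⟨Real.toEReal, rfl⟩, EReal.coe_add⟩ : ℝ →+ EReal) _ _
  rw [h, hsum]
  refine Finset.sum_congr rfl fun y _ => ?_
  rw [phiTerm, if_neg (hb y).ne', phiExt, if_pos (div_pos (ha y) (hb y)), EReal.coe_mul]

/-! ### Positivity, normalization and continuity of the manifest probabilities. -/

namespace Model

variable {k m t u : ℕ} (M : Model k m t u)

theorem itemProb_pos (θ : Param t u) (j : Fin m) (i : Fin k) : 0 < M.itemProb θ j i := by
  unfold itemProb; positivity

theorem itemProb_lt_one (θ : Param t u) (j : Fin m) (i : Fin k) : M.itemProb θ j i < 1 := by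
  unfold itemProb
  rw [div_lt_one (by positivity)]
  linarith

theorem condProb_pos (θ : Param t u) (j : Fin m) (y : Pattern k) : 0 < M.condProb θ j y := by
  refine Finset.prod_pos fun i _ => ?_
  split_ifs
  · exact M.itemProb_pos θ j i
  · linarith [M.itemProb_lt_one θ j i]

theorem sum_condProb (θ : Param t u) (j : Fin m) : ∑ y, M.condProb θ j y = 1 := by
  have := Finset.prod_univ_sum (fun _ : Fin k => (Finset.univ : Finset Bool))
    (fun i b => if b then M.itemProb θ j i else 1 - M.itemProb θ j i)
  simp only [Fintype.piFinset_univ, Fintype.sum_bool, if_true, Bool.false_eq_true, if_false,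
    add_sub_cancel, Finset.prod_const_one] at this
  exact this.symm

theorem manifest_pos [NeZero m] (θ : Param t u) (y : Pattern k) : 0 < M.manifest θ y := by
  refine Finset.sum_pos (fun j _ => mul_pos ?_ (M.condProb_pos θ j y)) ⟨0, Finset.mem_univ _⟩
  exact div_pos (Real.exp_pos _)
    (Finset.sum_pos (fun h _ => Real.exp_pos _) ⟨0, Finset.mem_univ _⟩)

theorem sum_manifest [NeZero m] (θ : Param t u) : ∑ y, M.manifest θ y = 1 := by
  have hpos : 0 < ∑ h, Real.exp (M.classLogit θ h) :=
    Finset.sum_pos (fun h _ => Real.exp_pos _) ⟨0, Finset.mem_univ _⟩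
  calc ∑ y, M.manifest θ y = ∑ j, ∑ y, M.classWeight θ j * M.condProb θ j y :=
        by simp only [manifest]; exact Finset.sum_comm
    _ = ∑ j, M.classWeight θ j := by simp [← Finset.mul_sum, sum_condProb]
    _ = 1 := by
        simp only [classWeight]
        rw [← Finset.sum_div, div_self hpos.ne']

theorem neZero_of_pos {θ : Param t u} {y : Pattern k} (h : 0 < M.manifest θ y) : NeZero m := by
  refine ⟨fun h0 => ?_⟩
  subst h0
  simp [manifest] at h

theorem continuous_manifest : Continuous M.manifest := by
  unfold manifest classWeight condProb itemProb classLogit itemLogit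
  refine (PiLp.continuous_toLp 2 _).comp (continuous_pi fun y => ?_)
  refine continuous_finsetSum _ fun j _ => ?_
  refine Continuous.mul (Continuous.div (by fun_prop) (by fun_prop) fun θ => ?_)
    (continuous_finsetProd _ fun i _ => ?_)
  · exact (Finset.sum_pos (fun h _ => Real.exp_pos _) ⟨j, Finset.mem_univ _⟩).ne'
  · split_ifs
    · exact Continuous.div (by fun_prop) (by fun_prop) fun θ => by positivity
    · exact continuous_const.sub
        (Continuous.div (by fun_prop) (by fun_prop) fun θ => by positivity)

end Model

/-! ### Approximate minimizers of a distance in an inner product space. -/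

section Projection

variable {α E : Type*} [NormedAddCommGroup E] [InnerProductSpace ℝ E] {l : Filter α}

theorem isLittleO_norm_add_sq_sub {x u v : α → E} (hu : u =O[l] x) (hv : v =o[l] x) :
    (fun a => ‖u a + v a‖ ^ 2 - ‖u a‖ ^ 2) =o[l] fun a => ‖x a‖ ^ 2 := by
  have h1 : (fun a => inner ℝ (u a) (v a)) =o[l] fun a => ‖x a‖ ^ 2 := by
    have h : (fun a => ‖u a‖ * ‖v a‖) =o[l] fun a => ‖x a‖ * ‖x a‖ :=
      hu.norm_norm.mul_isLittleO hv.norm_norm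
    simp only [← sq] at h
    refine (IsBigO.of_bound 1 (Eventually.of_forall fun a => ?_)).trans_isLittleO h
    rw [one_mul, Real.norm_of_nonneg (by positivity : 0 ≤ ‖u a‖ * ‖v a‖)]
    exact norm_inner_le_norm _ _
  have h2 : (fun a => ‖v a‖ ^ 2) =o[l] fun a => ‖x a‖ ^ 2 := hv.norm_norm.pow two_pos
  refine ((h1.const_mul_left 2).add h2).congr_left fun a => ?_
  rw [norm_add_sq_real]
  ring

/-- Asymptotic form of the fact that an orthogonal projection minimizes the distance: let `Fx` and
`Fy` be close to `c ‖x‖²` and `c ‖y‖²`, where `x` is close to `h - w` and `y` is close to `h - q`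
with `q - w` orthogonal to `h - q`. If `Fx ≤ Fy`, then `w` is close to `q`. -/
theorem isLittleO_sub_of_le {Fx Fy : α → ℝ} {x y h w q : α → E} {c : ℝ} (hc : 0 < c)
    (hle : ∀ᶠ a in l, Fx a ≤ Fy a)
    (hFx : (fun a => Fx a - c * ‖x a‖ ^ 2) =o[l] fun a => ‖x a‖ ^ 2)
    (hFy : (fun a => Fy a - c * ‖y a‖ ^ 2) =o[l] fun a => ‖y a‖ ^ 2)
    (hx : (fun a => x a - (h a - w a)) =o[l] w) (hy : (fun a => y a - (h a - q a)) =o[l] h)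
    (hq : q =O[l] h) (horth : ∀ a, inner ℝ (h a - q a) (q a - w a) = 0) :
    w =O[l] h ∧ (fun a => w a - q a) =o[l] h := by
  have hhq : (fun a => h a - q a) =O[l] h := (isBigO_refl h l).sub hq
  have hyO : y =O[l] h := (hy.isBigO.add hhq).congr_left fun a => by abel
  have hyO2 : (fun a => ‖y a‖ ^ 2) =O[l] fun a => ‖h a‖ ^ 2 := hyO.norm_norm.pow 2
  have hFyO : Fy =O[l] fun a => ‖h a‖ ^ 2 :=
    ((hFy.isBigO.trans hyO2).add (hyO2.const_mul_left c)).congr_left fun a => by ring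
  -- The constant is `2 / c` because half of `c * ‖x‖ ^ 2` survives the error in `hFx`, so that `c /
  -- 2 * ‖x‖ ^ 2 ≤ Fx ≤ Fy`.
  have hxO2 : (fun a => ‖x a‖ ^ 2) =O[l] fun a => ‖h a‖ ^ 2 := by
    refine (IsBigO.of_bound (2 / c) ?_).trans hFyO
    filter_upwards [hle, hFx.def (half_pos hc)] with a h1 h2
    rw [Real.norm_of_nonneg (sq_nonneg ‖x a‖)] at h2 ⊢
    have h3 := neg_le_of_abs_le h2
    have h4 := le_abs_self (Fy a)
    rw [div_mul_eq_mul_div, le_div_iff₀ hc, Real.norm_eq_abs]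
    linarith
  have hxO : x =O[l] h := (IsBigO.of_pow two_ne_zero hxO2).of_norm_norm
  -- The error in `hx` is relative to `w`, whose size is not yet known; it is absorbed, giving `w =
  -- O(h - x)`.
  have hwO : w =O[l] h := by
    refine hx.right_isBigO_sub.trans (((isBigO_refl h l).sub hxO).congr_left fun a => by abel)
  have hxo : (fun a => x a - (h a - w a)) =o[l] h := hx.trans_isBigO hwO
  have hhw : (fun a => h a - w a) =O[l] h := (isBigO_refl h l).sub hwO
  have d1 := isLittleO_norm_add_sq_sub hhw hxo
  have d2 := isLittleO_norm_add_sq_sub hhq hy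
  have hg := ((hFy.trans_isBigO hyO2).sub (hFx.trans_isBigO (hxO2))).const_mul_left c⁻¹
  -- By Pythagoras this combination equals `c⁻¹ * (Fy - Fx) + ‖w - q‖ ^ 2`, a sum of two nonnegative
  -- terms.
  have hG := (hg.sub d1).add d2
  have hsq : (fun a => ‖w a - q a‖ ^ 2) =o[l] fun a => ‖h a‖ ^ 2 := by
    refine (IsBigO.of_bound 1 ?_).trans_isLittleO hG
    filter_upwards [hle] with a hlea
    rw [one_mul, Real.norm_of_nonneg (sq_nonneg _)]
    refine le_trans ?_ (le_abs_self _)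
    have e1 : ‖h a - w a‖ ^ 2 = ‖h a - q a‖ ^ 2 + ‖w a - q a‖ ^ 2 := by
      rw [show h a - w a = (h a - q a) + (q a - w a) by abel, norm_add_sq_real, horth,
        norm_sub_rev (q a)]
      ring
    have e2 : c⁻¹ * (Fy a - c * ‖y a‖ ^ 2 - (Fx a - c * ‖x a‖ ^ 2))
        = c⁻¹ * (Fy a - Fx a) + ‖x a‖ ^ 2 - ‖y a‖ ^ 2 := by field_simp; ring
    have e3 : 0 ≤ c⁻¹ * (Fy a - Fx a) := mul_nonneg (inv_pos.2 hc).le (sub_nonneg.2 hlea)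
    rw [e2, add_sub_cancel, add_sub_cancel, e1]
    linarith
  exact ⟨hwO, (IsLittleO.of_pow hsq two_ne_zero).of_norm_norm⟩

end Projection

/-! ### Matrix identities for the weighted projection. -/

namespace Model

variable {k m t u : ℕ} (M : Model k m t u)

/-- `J (AᵀA)⁻¹ Jᵀ D_p⁻¹`, the projection onto the range of `J` that is orthogonal with respect to
the inner product with matrix `D_p⁻¹`. -/
def projMatrix (θ : Param t u) : Matrix (Pattern k) (Pattern k) ℝ :=
  M.jacobian θ * ((M.scaledJacobian θ)ᵀ * M.scaledJacobian θ)⁻¹ * (M.jacobian θ)ᵀ *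
    Matrix.diagonal fun y => (M.manifest θ y)⁻¹

variable {M} {θ : Param t u}

theorem gram_eq (hpos : ∀ y, 0 < M.manifest θ y) :
    (M.scaledJacobian θ)ᵀ * M.scaledJacobian θ
      = (M.jacobian θ)ᵀ * (Matrix.diagonal fun y => (M.manifest θ y)⁻¹) * M.jacobian θ := by
  have h : (Matrix.diagonal fun y => (√(M.manifest θ y))⁻¹)
      * (Matrix.diagonal fun y => (√(M.manifest θ y))⁻¹)
      = Matrix.diagonal fun y => (M.manifest θ y)⁻¹ := by
    rw [Matrix.diagonal_mul_diagonal]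
    congr 1
    ext y
    rw [← mul_inv, Real.mul_self_sqrt (hpos y).le]
  rw [← h, scaledJacobian, Matrix.transpose_mul, Matrix.diagonal_transpose]
  simp only [Matrix.mul_assoc]

theorem isUnit_gram_det (hpos : ∀ y, 0 < M.manifest θ y)
    (hrank : (M.jacobian θ).rank = t + u) :
    IsUnit ((M.scaledJacobian θ)ᵀ * M.scaledJacobian θ).det := by
  have hA : (M.scaledJacobian θ).rank = t + u := by
    rw [scaledJacobian, Matrix.rank_mul_eq_right_of_isUnit_det, hrank]
    rw [Matrix.det_diagonal, isUnit_iff_ne_zero]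
    exact Finset.prod_ne_zero_iff.2 fun y _ => (inv_pos.2 (Real.sqrt_pos.2 (hpos y))).ne'
  rw [← Matrix.isUnit_iff_isUnit_det, ← Matrix.mulVec_surjective_iff_isUnit]
  rw [← Matrix.rank_transpose_mul_self, Matrix.rank] at hA
  exact LinearMap.range_eq_top.1 (Submodule.eq_top_of_finrank_eq (hA.trans (by simp)))

/-- These are the normal equations: residuals of the projection are orthogonal to the columns of `J`
with weights `D_p⁻¹`. -/
theorem jacobian_transpose_mul_projMatrix (hpos : ∀ y, 0 < M.manifest θ y)
    (hrank : (M.jacobian θ).rank = t + u) :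
    (M.jacobian θ)ᵀ * (Matrix.diagonal fun y => (M.manifest θ y)⁻¹) * M.projMatrix θ
      = (M.jacobian θ)ᵀ * Matrix.diagonal fun y => (M.manifest θ y)⁻¹ := by
  have hU := isUnit_gram_det hpos hrank
  have hg := gram_eq hpos
  rw [projMatrix]
  simp only [← Matrix.mul_assoc]
  rw [← hg, Matrix.mul_nonsing_inv _ hU, Matrix.one_mul]

theorem sum_jacobian_eq_zero [NeZero m] (hd : DifferentiableAt ℝ M.manifest θ)
    (s : Fin t ⊕ Fin u) : ∑ y, M.jacobian θ y s = 0 := by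
  have hdy : ∀ y, DifferentiableAt ℝ (fun θ' => M.manifest θ' y) θ := fun y =>
    (EuclideanSpace.proj (𝕜 := ℝ) y).differentiableAt.comp θ hd
  have h1 : fderiv ℝ (fun θ' => ∑ y, M.manifest θ' y) θ = 0 := by
    rw [show (fun θ' => ∑ y, M.manifest θ' y) = fun _ => (1 : ℝ) from funext M.sum_manifest]
    simp
  rw [fderiv_fun_sum fun y _ => hdy y] at h1
  have := congrArg (fun f => f (EuclideanSpace.single s (1 : ℝ))) h1
  simpa [jacobian] using this

/-- `D_p⁻¹ p` is the all-ones vector, and the columns of `J` sum to zero because probabilities sum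
to one. This centres the summands in the central limit theorem. -/
theorem projMatrix_mulVec_manifest [NeZero m] (hpos : ∀ y, 0 < M.manifest θ y)
    (hd : DifferentiableAt ℝ M.manifest θ) : M.projMatrix θ *ᵥ M.manifest θ = 0 := by
  have h1 : (Matrix.diagonal fun y => (M.manifest θ y)⁻¹) *ᵥ M.manifest θ = 1 := by
    ext y
    rw [Matrix.mulVec_diagonal, inv_mul_cancel₀ (hpos y).ne', Pi.one_apply]
  have h2 : (M.jacobian θ)ᵀ *ᵥ 1 = 0 := by
    ext s
    simpa [Matrix.mulVec, dotProduct] using sum_jacobian_eq_zero hd s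
  rw [projMatrix, ← Matrix.mulVec_mulVec, h1, ← Matrix.mulVec_mulVec, h2, Matrix.mulVec_zero]

theorem projMatrix_mul_diagonal_mul_transpose (hpos : ∀ y, 0 < M.manifest θ y)
    (hrank : (M.jacobian θ).rank = t + u) :
    M.projMatrix θ * Matrix.diagonal (M.manifest θ) * (M.projMatrix θ)ᵀ
      = M.jacobian θ * ((M.scaledJacobian θ)ᵀ * M.scaledJacobian θ)⁻¹ * (M.jacobian θ)ᵀ := by
  have hU := isUnit_gram_det hpos hrank
  have hg := gram_eq hpos
  have hD : (Matrix.diagonal fun y => (M.manifest θ y)⁻¹) * Matrix.diagonal (M.manifest θ) = 1 := by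
    rw [Matrix.diagonal_mul_diagonal, ← Matrix.diagonal_one]
    congr 1
    ext y
    exact inv_mul_cancel₀ (hpos y).ne'
  have hsymm : (((M.scaledJacobian θ)ᵀ * M.scaledJacobian θ)⁻¹)ᵀ
      = ((M.scaledJacobian θ)ᵀ * M.scaledJacobian θ)⁻¹ := by
    rw [Matrix.transpose_nonsing_inv, Matrix.transpose_mul, Matrix.transpose_transpose]
  set G := (M.scaledJacobian θ)ᵀ * M.scaledJacobian θ with hG
  set J := M.jacobian θ
  calc _ = J * G⁻¹ * Jᵀ * ((Matrix.diagonal fun y => (M.manifest θ y)⁻¹)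
        * Matrix.diagonal (M.manifest θ)) * (M.projMatrix θ)ᵀ := by
        rw [projMatrix, ← hG]; simp only [Matrix.mul_assoc, J]
    _ = J * G⁻¹ * (Jᵀ * (Matrix.diagonal fun y => (M.manifest θ y)⁻¹) * J) * G⁻¹ * Jᵀ := by
        rw [hD, projMatrix, ← hG]
        simp only [Matrix.transpose_mul, Matrix.transpose_transpose, Matrix.diagonal_transpose,
          hsymm, Matrix.mul_assoc, J, Matrix.one_mul]
    _ = _ := by rw [← hg, Matrix.mul_assoc J, Matrix.nonsing_inv_mul _ hU, Matrix.mul_one]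

theorem posSemidef_covariance :
    (M.jacobian θ * ((M.scaledJacobian θ)ᵀ * M.scaledJacobian θ)⁻¹
      * (M.jacobian θ)ᵀ).PosSemidef := by
  have h := (Matrix.posSemidef_conjTranspose_mul_self (M.scaledJacobian θ)).inv
  simpa using h.mul_mul_conjTranspose_same (M.jacobian θ)

end Model

/-! ### Existence, consistency and linearization of minimizers. -/

namespace Model

variable {k m t u : ℕ} {M : Model k m t u} {Θ : Set (Param t u)} {θ₀ : Param t u} {φ : ℝ → ℝ}

theorem hasFDerivAt_manifest {θ : Param t u} (hd : DifferentiableAt ℝ M.manifest θ) :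
    HasFDerivAt M.manifest
      (Matrix.toLpLin 2 2 (M.jacobian θ)).toContinuousLinearMap θ := by
  convert hd.hasFDerivAt using 1
  ext v y
  have hdy : fderiv ℝ (fun θ' => M.manifest θ' y) θ
      = (EuclideanSpace.proj (𝕜 := ℝ) y).comp (fderiv ℝ M.manifest θ) :=
    ((EuclideanSpace.proj (𝕜 := ℝ) y).hasFDerivAt.comp θ hd.hasFDerivAt).fderiv
  have hv : v = ∑ s, v s • EuclideanSpace.single s (1 : ℝ) := by
    simpa only [EuclideanSpace.basisFun_repr, EuclideanSpace.basisFun_apply] using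
      ((EuclideanSpace.basisFun (Fin t ⊕ Fin u) ℝ).sum_repr v).symm
  have h1 : fderiv ℝ (fun θ' => M.manifest θ' y) θ v = ∑ s, M.jacobian θ y s * v s := by
    conv_lhs => rw [hv]
    rw [map_sum]
    refine Finset.sum_congr rfl fun s _ => ?_
    rw [map_smul, smul_eq_mul, mul_comm]
    rfl
  rw [hdy] at h1
  simpa [Matrix.mulVec, dotProduct, Matrix.toLpLin_apply] using h1.symm

theorem eventually_pos {p : PatternVec k} (hp : ∀ y, 0 < p y) :
    ∀ᶠ a in 𝓝 p, ∀ y, 0 < a y :=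
  eventually_all.2 fun y =>
    (EuclideanSpace.proj (𝕜 := ℝ) y).continuous.continuousAt.eventually (lt_mem_nhds (hp y))

theorem tendsto_sum_centered {ι : Type*} [Fintype ι] (h1 : φ 1 = 0)
    (hs : ContDiffOn ℝ 2 φ (Set.Ioi 0)) {p : EuclideanSpace ℝ ι} (hp : ∀ y, 0 < p y) :
    Tendsto (fun a : EuclideanSpace ℝ ι => ∑ y, p y * centered φ (a y / p y)) (𝓝 p) (𝓝 0) := by
  have hc : ContinuousAt (centered φ) 1 :=
    ((hs.continuousOn.continuousAt (Ioi_mem_nhds one_pos)).sub (by fun_prop))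
  have hc0 : Tendsto (centered φ) (𝓝 1) (𝓝 0) := by
    simpa [centered, h1] using hc.tendsto
  rw [← Finset.sum_const_zero (s := (Finset.univ : Finset ι))]
  refine tendsto_finsetSum _ fun y _ => ?_
  have hd : Tendsto (fun a : EuclideanSpace ℝ ι => a y / p y) (𝓝 p) (𝓝 1) := by
    rw [← div_self (hp y).ne']
    exact (EuclideanSpace.proj (𝕜 := ℝ) y).continuous.continuousAt.tendsto.div_const _
  simpa using (hc0.comp hd).const_mul (p y)

theorem continuous_sum_centered [NeZero m] (hs : ContDiffOn ℝ 2 φ (Set.Ioi 0))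
    {a : PatternVec k} (ha : ∀ y, 0 < a y) :
    Continuous fun θ => ∑ y, M.manifest θ y * centered φ (a y / M.manifest θ y) := by
  have hc : ContinuousOn (centered φ) (Set.Ioi 0) := hs.continuousOn.sub (by fun_prop)
  have hm : ∀ y, Continuous fun θ => M.manifest θ y := fun y =>
    (EuclideanSpace.proj (𝕜 := ℝ) y).continuous.comp M.continuous_manifest
  refine continuous_finsetSum _ fun y _ => (hm y).mul ?_
  exact hc.comp_continuous (continuous_const.div (hm y) fun θ => (M.manifest_pos θ y).ne')
    fun θ => div_pos (ha y) (M.manifest_pos θ y)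

theorem phiDivergence_manifest [NeZero m] {a : PatternVec k} (ha : ∀ y, 0 < a y)
    (ha1 : ∑ y, a y = 1) (θ : Param t u) :
    phiDivergence φ a (M.manifest θ)
      = ((∑ y, M.manifest θ y * centered φ (a y / M.manifest θ y) : ℝ) : EReal) :=
  phiDivergence_eq_coe ha (M.manifest_pos θ) (ha1.trans (M.sum_manifest θ).symm)

/-- A minimizer exists as soon as `a` is close to the true manifest probabilities. -/
theorem eventually_nonempty_argminPhi [NeZero m] (hθ₀ : θ₀ ∈ interior Θ)
    (hB : M.Birch Θ θ₀) (hφ : IsDivergenceFunction φ) (hs : ContDiffOn ℝ 2 φ (Set.Ioi 0))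
    (hne : iteratedDeriv 2 φ 1 ≠ 0) :
    ∀ᶠ a in 𝓝 (M.manifest θ₀), ∑ y, a y = 1 → (M.argminPhi φ Θ a).Nonempty := by
  obtain ⟨ρ, hρ, hΘ⟩ := Metric.nhds_basis_closedBall.mem_iff.1 (mem_interior_iff_mem_nhds.1 hθ₀)
  obtain ⟨V, hV, hVU⟩ := hB.inv_cont _ (Metric.closedBall_mem_nhds θ₀ hρ)
  obtain ⟨ε, hε, hεV⟩ := Metric.mem_nhds_iff.1 hV
  obtain ⟨η, hη, hclose⟩ := exists_norm_sub_lt_of_sum_centered_lt (ι := Pattern k) hφ hs hne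
    (half_pos hε)
  filter_upwards [eventually_pos hB.pos, Metric.ball_mem_nhds _ (half_pos hε),
    (tendsto_sum_centered hφ.map_one hs hB.pos).eventually (gt_mem_nhds hη)] with a ha hab hlt ha1
  obtain ⟨θ, hθ, hmin⟩ := (isCompact_closedBall θ₀ ρ).exists_isMinOn
    ⟨θ₀, Metric.mem_closedBall_self hρ.le⟩ (continuous_sum_centered (M := M) hs ha).continuousOn
  refine ⟨θ, hΘ hθ, fun θ' hθ' => ?_⟩
  rw [phiDivergence_manifest ha ha1, phiDivergence_manifest ha ha1, EReal.coe_le_coe_iff]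
  by_cases hcl : θ' ∈ Metric.closedBall θ₀ ρ
  · exact hmin hcl
  -- Outside the ball, a value below the one at `θ₀` would be less than `η`; then `M.manifest θ'`
  -- would lie in `V`, which puts `θ'` back in the ball.
  · refine (hmin (Metric.mem_closedBall_self hρ.le)).trans ?_
    by_contra hcon
    have h1 := hclose a (M.manifest θ') ha (M.manifest_pos θ') (M.sum_manifest θ')
      ((not_le.1 hcon).trans hlt)
    refine hcl (hVU θ' hθ' (hεV ?_))
    rw [Metric.mem_ball, dist_eq_norm] at hab ⊢
    calc ‖M.manifest θ' - M.manifest θ₀‖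
        = ‖(a - M.manifest θ₀) - (a - M.manifest θ')‖ := by congr 1; abel
      _ ≤ ‖a - M.manifest θ₀‖ + ‖a - M.manifest θ'‖ := norm_sub_le _ _
      _ < ε := by linarith

variable (M Θ θ₀ φ) in
/-- The filter of the pairs of a probability vector that tends to `p(θ₀)` and a minimizer for it. -/
def minimizerFilter : Filter (PatternVec k × Param t u) :=
  comap Prod.fst (𝓝 (M.manifest θ₀)) ⊓ 𝓟 {x | ∑ y, x.1 y = 1 ∧ x.2 ∈ M.argminPhi φ Θ x.1}

theorem tendsto_fst_minimizerFilter :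
    Tendsto Prod.fst (M.minimizerFilter Θ θ₀ φ) (𝓝 (M.manifest θ₀)) :=
  tendsto_comap.mono_left inf_le_left

theorem eventually_minimizerFilter : ∀ᶠ x in M.minimizerFilter Θ θ₀ φ,
    ∑ y, x.1 y = 1 ∧ x.2 ∈ M.argminPhi φ Θ x.1 :=
  mem_inf_of_right (mem_principal_self _)

/-- The competitor may depend on `a`: the constant `θ₀` yields consistency, `θ₀ + K (a - p)` the
first order expansion. -/
theorem eventually_sum_le [NeZero m] (hB : M.Birch Θ θ₀) {θ : PatternVec k → Param t u}
    (hθ : ∀ᶠ a in 𝓝 (M.manifest θ₀), θ a ∈ Θ) :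
    ∀ᶠ x in M.minimizerFilter Θ θ₀ φ,
      ∑ y, M.manifest x.2 y * centered φ (x.1 y / M.manifest x.2 y)
        ≤ ∑ y, M.manifest (θ x.1) y * centered φ (x.1 y / M.manifest (θ x.1) y) := by
  filter_upwards [eventually_minimizerFilter, tendsto_fst_minimizerFilter.eventually hθ,
    tendsto_fst_minimizerFilter.eventually (eventually_pos hB.pos)] with x hx hθx hpos
  have := hx.2.2 _ hθx
  rwa [phiDivergence_manifest hpos hx.1, phiDivergence_manifest hpos hx.1,
    EReal.coe_le_coe_iff] at this

theorem tendsto_manifest_minimizerFilter [NeZero m] (hθ₀ : θ₀ ∈ interior Θ)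
    (hB : M.Birch Θ θ₀) (hφ : IsDivergenceFunction φ) (hs : ContDiffOn ℝ 2 φ (Set.Ioi 0))
    (hne : iteratedDeriv 2 φ 1 ≠ 0) :
    Tendsto (fun x : PatternVec k × Param t u => M.manifest x.2) (M.minimizerFilter Θ θ₀ φ)
      (𝓝 (M.manifest θ₀)) := by
  have h0 : Tendsto (fun x : PatternVec k × Param t u => x.1 - M.manifest x.2)
      (M.minimizerFilter Θ θ₀ φ) (𝓝 0) := by
    rw [Metric.tendsto_nhds]
    intro ε hε
    obtain ⟨η, hη, hclose⟩ :=
      exists_norm_sub_lt_of_sum_centered_lt (ι := Pattern k) hφ hs hne hε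
    filter_upwards [eventually_sum_le hB (θ := fun _ => θ₀)
        (Eventually.of_forall fun _ => interior_subset hθ₀),
      tendsto_fst_minimizerFilter.eventually (eventually_pos hB.pos),
      tendsto_fst_minimizerFilter.eventually
        ((tendsto_sum_centered hφ.map_one hs hB.pos).eventually (gt_mem_nhds hη))]
      with x h1 h2 h3
    rw [dist_zero_right]
    exact hclose _ _ h2 (M.manifest_pos _) (M.sum_manifest _) (h1.trans_lt h3)
  simpa using (tendsto_fst_minimizerFilter (Θ := Θ) (φ := φ)).sub h0

theorem tendsto_snd_minimizerFilter [NeZero m] (hθ₀ : θ₀ ∈ interior Θ)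
    (hB : M.Birch Θ θ₀) (hφ : IsDivergenceFunction φ) (hs : ContDiffOn ℝ 2 φ (Set.Ioi 0))
    (hne : iteratedDeriv 2 φ 1 ≠ 0) :
    Tendsto Prod.snd (M.minimizerFilter Θ θ₀ φ) (𝓝 θ₀) := by
  intro U hU
  obtain ⟨V, hV, hVU⟩ := hB.inv_cont U hU
  have h := (tendsto_manifest_minimizerFilter hθ₀ hB hφ hs hne).eventually_mem hV
  change ∀ᶠ x in M.minimizerFilter Θ θ₀ φ, x.2 ∈ U
  filter_upwards [eventually_minimizerFilter, h] with x hx hxV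
  exact hVU _ hx.2.1 hxV

theorem sqrtScale_invSqrtScale {p : PatternVec k} (hp : ∀ y, 0 < p y) (x : PatternVec k) :
    Matrix.toEuclideanCLM (𝕜 := ℝ) (Matrix.diagonal fun y => √(p y)) (invSqrtScale p x) = x := by
  ext y
  rw [Matrix.ofLp_toEuclideanCLM, Matrix.mulVec_diagonal, invSqrtScale_apply,
    mul_inv_cancel_left₀ (Real.sqrt_pos.2 (hp y)).ne']

theorem leftInverse_jacobian (hpos : ∀ y, 0 < M.manifest θ₀ y)
    (hrank : (M.jacobian θ₀).rank = t + u) (v : Param t u) :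
    (Matrix.toLpLin 2 2 (((M.scaledJacobian θ₀)ᵀ * M.scaledJacobian θ₀)⁻¹
      * (M.jacobian θ₀)ᵀ * Matrix.diagonal fun y => (M.manifest θ₀ y)⁻¹)).toContinuousLinearMap
      ((Matrix.toLpLin 2 2 (M.jacobian θ₀)).toContinuousLinearMap v) = v := by
  ext s
  have h : ((M.scaledJacobian θ₀)ᵀ * M.scaledJacobian θ₀)⁻¹ * (M.jacobian θ₀)ᵀ
      * (Matrix.diagonal fun y => (M.manifest θ₀ y)⁻¹) * M.jacobian θ₀ = 1 := by
    rw [Matrix.mul_assoc _ _ (Matrix.diagonal _), Matrix.mul_assoc, ← gram_eq hpos,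
      Matrix.nonsing_inv_mul _ (isUnit_gram_det hpos hrank)]
  simp only [LinearMap.coe_toContinuousLinearMap', Matrix.toLpLin_apply, Matrix.mulVec_mulVec, h,
    Matrix.one_mulVec]

theorem inner_sub_projMatrix (hpos : ∀ y, 0 < M.manifest θ₀ y)
    (hrank : (M.jacobian θ₀).rank = t + u) (h : PatternVec k) (v : Param t u) :
    inner ℝ (invSqrtScale (M.manifest θ₀)
        (h - Matrix.toEuclideanCLM (𝕜 := ℝ) (M.projMatrix θ₀) h))
      (invSqrtScale (M.manifest θ₀)
        ((Matrix.toLpLin 2 2 (M.jacobian θ₀)).toContinuousLinearMap v)) = 0 := by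
  set d := h - Matrix.toEuclideanCLM (𝕜 := ℝ) (M.projMatrix θ₀) h with hd
  have hd0 : ((M.jacobian θ₀)ᵀ * Matrix.diagonal fun y => (M.manifest θ₀ y)⁻¹) *ᵥ d.ofLp = 0 := by
    rw [hd, WithLp.ofLp_sub, Matrix.ofLp_toEuclideanCLM, Matrix.mulVec_sub, Matrix.mulVec_mulVec,
      jacobian_transpose_mul_projMatrix hpos hrank, sub_self]
  have key : ∀ z : PatternVec k, inner ℝ (invSqrtScale (M.manifest θ₀) d)
      (invSqrtScale (M.manifest θ₀) z)
      = ((Matrix.diagonal fun y => (M.manifest θ₀ y)⁻¹) *ᵥ d.ofLp) ⬝ᵥ z.ofLp := fun z => by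
    rw [PiLp.inner_apply, dotProduct]
    refine Finset.sum_congr rfl fun y _ => ?_
    rw [invSqrtScale_apply, invSqrtScale_apply, Matrix.mulVec_diagonal]
    have h1 : (√(M.manifest θ₀ y))⁻¹ * (√(M.manifest θ₀ y))⁻¹ = (M.manifest θ₀ y)⁻¹ := by
      rw [← mul_inv, Real.mul_self_sqrt (hpos y).le]
    rw [← h1]
    simp
    ring
  rw [key]
  simp only [LinearMap.coe_toContinuousLinearMap', Matrix.toLpLin_apply]
  rw [Matrix.dotProduct_mulVec, ← Matrix.mulVec_transpose, Matrix.mulVec_mulVec, hd0,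
    zero_dotProduct]

/-- The matrices enter only through these operator identities: `K` is a left inverse of `J`, `L = J
K` is the projection, and `T` changes the weighted inner product into the standard one. -/
theorem manifest_minimizer_isLittleO_of_projection [NeZero m] (hθ₀ : θ₀ ∈ interior Θ)
    (hB : M.Birch Θ θ₀) (hφ : IsDivergenceFunction φ) (hs : ContDiffOn ℝ 2 φ (Set.Ioi 0))
    (hne : iteratedDeriv 2 φ 1 ≠ 0) {J : Param t u →L[ℝ] PatternVec k}
    {K : PatternVec k →L[ℝ] Param t u} {L S T : PatternVec k →L[ℝ] PatternVec k}
    (hder : HasFDerivAt M.manifest J θ₀) (hJK : ∀ h, J (K h) = L h) (hKJ : ∀ v, K (J v) = v)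
    (hT : T = invSqrtScale (M.manifest θ₀)) (hS : ∀ x, S (T x) = x)
    (horth : ∀ h v, inner ℝ (T (h - L h)) (T (J v)) = 0) :
    (fun x : PatternVec k × Param t u => M.manifest x.2 - M.manifest θ₀
        - L (x.1 - M.manifest θ₀))
      =o[M.minimizerFilter Θ θ₀ φ] fun x => x.1 - M.manifest θ₀ := by
  have hc0 : 0 < iteratedDeriv 2 φ 1 / 2 := half_pos (iteratedDeriv_two_pos hφ hs hne)
  have hfst := tendsto_fst_minimizerFilter (M := M) (Θ := Θ) (θ₀ := θ₀) (φ := φ)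
  set l := M.minimizerFilter Θ θ₀ φ
  set p := M.manifest θ₀
  have hman := tendsto_manifest_minimizerFilter hθ₀ hB hφ hs hne
  have hsnd := tendsto_snd_minimizerFilter hθ₀ hB hφ hs hne
  let θs : PatternVec k → Param t u := fun a => θ₀ + K (a - p)
  have hθs : Tendsto θs (𝓝 p) (𝓝 θ₀) := by
    have : Continuous θs := by fun_prop
    simpa [θs] using this.tendsto p
  -- The left inverses `S` and `K` bound `T` and `J` from below, so errors relative to `θ - θ₀` can
  -- be measured by `T (J (θ - θ₀))`.
  have hTO : ∀ f : PatternVec k × Param t u → PatternVec k, f =O[l] fun x => T (f x) := fun f =>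
    (S.isBigO_comp (fun x => T (f x)) l).congr_left fun x => hS _
  have hJO : (fun x : PatternVec k × Param t u => x.2 - θ₀) =O[l]
      fun x => T (J (x.2 - θ₀)) :=
    ((K.isBigO_comp (fun x => J (x.2 - θ₀)) l).congr_left fun x => hKJ _).trans (hTO _)
  have hquad := sum_centered_isLittleO hφ.map_one hs hB.pos
  rw [← hT] at hquad
  have hmain := isLittleO_sub_of_le (l := l) (c := iteratedDeriv 2 φ 1 / 2)
    (Fx := fun x => ∑ y, M.manifest x.2 y * centered φ (x.1 y / M.manifest x.2 y))
    (Fy := fun x => ∑ y, M.manifest (θs x.1) y * centered φ (x.1 y / M.manifest (θs x.1) y))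
    (x := fun x => T (x.1 - M.manifest x.2)) (y := fun x => T (x.1 - M.manifest (θs x.1)))
    (h := fun x => T (x.1 - p)) (w := fun x => T (J (x.2 - θ₀)))
    (q := fun x => T (L (x.1 - p))) hc0
    (eventually_sum_le hB (hθs (mem_interior_iff_mem_nhds.1 hθ₀)))
    (hquad.comp_tendsto (hfst.prodMk_nhds hman))
    (hquad.comp_tendsto (hfst.prodMk_nhds
      (M.continuous_manifest.continuousAt.tendsto.comp (hθs.comp hfst))))
    ?_ ?_ ?_ fun x => ?_
  rotate_left
  · have h1 : (fun x : PatternVec k × Param t u => M.manifest x.2 - p - J (x.2 - θ₀))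
        =o[l] fun x => x.2 - θ₀ := hder.isLittleO.comp_tendsto hsnd
    refine (((T.isBigO_comp _ l).trans_isLittleO h1).trans_isBigO hJO).neg_left.congr_left
      fun x => ?_
    rw [← map_neg, ← map_sub, ← map_sub]
    congr 1
    abel
  · have h1 : (fun x : PatternVec k × Param t u =>
        M.manifest (θs x.1) - p - J (θs x.1 - θ₀)) =o[l] fun x => θs x.1 - θ₀ :=
      hder.isLittleO.comp_tendsto (hθs.comp hfst)
    have h2 : (fun x : PatternVec k × Param t u => θs x.1 - θ₀) =O[l] fun x => T (x.1 - p) :=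
      ((K.isBigO_comp (fun x : PatternVec k × Param t u => x.1 - p) l).congr_left fun x => by
        simp [θs]).trans (hTO _)
    refine (((T.isBigO_comp _ l).trans_isLittleO h1).trans_isBigO h2).neg_left.congr_left
      fun x => ?_
    rw [show θs x.1 - θ₀ = K (x.1 - p) by simp [θs], hJK, ← map_neg, ← map_sub, ← map_sub]
    congr 1
    abel
  · exact ((T.comp L).isBigO_comp (fun x : PatternVec k × Param t u => x.1 - p) l).trans (hTO _)
  · rw [← map_sub, ← map_sub, ← hJK (x.1 - p), ← map_sub, hJK]
    exact horth _ _
  · have h2 := (hder.isLittleO.comp_tendsto hsnd).trans_isBigO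
      (hJO.trans (hmain.1.trans (T.isBigO_comp _ l)))
    have h3 : (fun x : PatternVec k × Param t u => J (x.2 - θ₀) - L (x.1 - p))
        =o[l] fun x => x.1 - p :=
      (hTO _).trans_isLittleO ((hmain.2.congr_left fun x => (map_sub T _ _).symm).trans_isBigO
        (T.isBigO_comp _ l))
    refine (h2.add h3).congr_left fun x => ?_
    simp only [Function.comp]
    abel

/-- The manifest probabilities at the minimizer are differentiable in the vector of relative
frequencies, with derivative `projMatrix`. -/
theorem manifest_minimizer_isLittleO [NeZero m] (hθ₀ : θ₀ ∈ interior Θ)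
    (hB : M.Birch Θ θ₀) (hφ : IsDivergenceFunction φ) (hs : ContDiffOn ℝ 2 φ (Set.Ioi 0))
    (hne : iteratedDeriv 2 φ 1 ≠ 0) :
    (fun x : PatternVec k × Param t u => M.manifest x.2 - M.manifest θ₀
        - Matrix.toEuclideanCLM (𝕜 := ℝ) (M.projMatrix θ₀) (x.1 - M.manifest θ₀))
      =o[M.minimizerFilter Θ θ₀ φ] fun x => x.1 - M.manifest θ₀ := by
  refine manifest_minimizer_isLittleO_of_projection hθ₀ hB hφ hs hne
    (hasFDerivAt_manifest hB.diff) (fun h => ?_) (leftInverse_jacobian hB.pos hB.rank_eq) rfl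
    (sqrtScale_invSqrtScale hB.pos) (inner_sub_projMatrix hB.pos hB.rank_eq)
  ext y
  simp only [projMatrix, LinearMap.coe_toContinuousLinearMap', Matrix.toLpLin_apply,
    Matrix.ofLp_toEuclideanCLM, Matrix.mulVec_mulVec, Matrix.mul_assoc]

end Model

/-! ### Relative frequencies as averages. -/

section Empirical

variable {k : ℕ} {Ω : Type*}

theorem empirical_apply (Y : ℕ → Ω → Pattern k) (N : ℕ) (ω : Ω) (y : Pattern k) :
    empirical Y N ω y
      = (∑ n ∈ Finset.range N, (Pi.single y 1 : Pattern k → ℝ) (Y n ω)) / N := by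
  simp only [empirical, Finset.card_filter, Nat.cast_sum, Nat.cast_ite, Nat.cast_one,
    Nat.cast_zero, Pi.single_apply]

theorem sum_mul_empirical (Y : ℕ → Ω → Pattern k) (N : ℕ) (ω : Ω) (g : Pattern k → ℝ) :
    ∑ y, g y * empirical Y N ω y = (∑ n ∈ Finset.range N, g (Y n ω)) / N := by
  simp only [empirical_apply, mul_div_assoc', Finset.mul_sum, ← Finset.sum_div]
  rw [Finset.sum_comm]
  simp [Pi.single_apply]

theorem sum_empirical (Y : ℕ → Ω → Pattern k) {N : ℕ} (hN : 0 < N) (ω : Ω) :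
    ∑ y, empirical Y N ω y = 1 := by
  have h := sum_mul_empirical Y N ω 1
  have : (N : ℝ) ≠ 0 := by positivity
  simpa [this] using h

theorem measurable_empirical [MeasurableSpace Ω] {Y : ℕ → Ω → Pattern k}
    (hY : ∀ n, Measurable (Y n)) (N : ℕ) : Measurable (empirical Y N) := by
  refine (WithLp.measurable_toLp 2 (Pattern k → ℝ)).comp (measurable_pi_lambda _ fun y => ?_)
  refine Measurable.div_const ?_ _
  have : (fun ω => (((Finset.range N).filter fun n => Y n ω = y).card : ℝ))
      = fun ω => ∑ n ∈ Finset.range N, (Pi.single y 1 : Pattern k → ℝ) (Y n ω) := by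
    ext ω
    simp only [Finset.card_filter, Nat.cast_sum, Nat.cast_ite, Nat.cast_one,
      Nat.cast_zero, Pi.single_apply]
  rw [this]
  exact Finset.measurable_fun_sum _ fun n _ =>
    (Measurable.of_discrete (f := Pi.single y (1 : ℝ))).comp (hY n)

end Empirical

/-! ### Moments and central limit theorem for the sample. -/

namespace Model.IsSample

variable {k m t u : ℕ} {M : Model k m t u} {θ₀ : Param t u} {Ω : Type*} [MeasurableSpace Ω]
  {P : Measure Ω} {Y : ℕ → Ω → Pattern k}

theorem identDistrib [IsProbabilityMeasure P] (hY : M.IsSample θ₀ P Y) (n : ℕ) :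
    IdentDistrib (Y n) (Y 0) P P where
  aemeasurable_fst := (hY.measurable n).aemeasurable
  aemeasurable_snd := (hY.measurable 0).aemeasurable
  map_eq := by
    have := fun n => Measure.isProbabilityMeasure_map (μ := P) (hY.measurable n).aemeasurable
    refine (ext_iff_measureReal_singleton).2 fun y => ?_
    rw [map_measureReal_apply (hY.measurable n) (measurableSet_singleton y),
      map_measureReal_apply (hY.measurable 0) (measurableSet_singleton y), hY.law, hY.law]

theorem integral_comp [IsProbabilityMeasure P] (hY : M.IsSample θ₀ P Y) (n : ℕ)
    (g : Pattern k → ℝ) :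
    ∫ ω, g (Y n ω) ∂P = ∑ y, M.manifest θ₀ y * g y := by
  have := Measure.isProbabilityMeasure_map (μ := P) (hY.measurable n).aemeasurable
  rw [← integral_map (f := g) (hY.measurable n).aemeasurable (by fun_prop),
    integral_fintype .of_finite]
  refine Finset.sum_congr rfl fun y _ => ?_
  rw [map_measureReal_apply (hY.measurable n) (measurableSet_singleton y), hY.law, smul_eq_mul]

theorem memLp_comp [IsProbabilityMeasure P] (hY : M.IsSample θ₀ P Y) (n : ℕ)
    (g : Pattern k → ℝ) :
    MemLp (fun ω => g (Y n ω)) 2 P := by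
  have := Measure.isProbabilityMeasure_map (μ := P) (hY.measurable n).aemeasurable
  exact (MemLp.of_discrete (f := g) (μ := P.map (Y n)) (p := 2)).comp_of_map
    (hY.measurable n).aemeasurable

theorem iIndepFun_comp (hY : M.IsSample θ₀ P Y) (g : Pattern k → ℝ) :
    iIndepFun (fun n ω => g (Y n ω)) P :=
  hY.indep.comp (fun _ => g) fun _ => .of_discrete

/-- Central limit theorem for linear functions of the relative frequencies. -/
theorem tendstoInDistribution_sum [IsProbabilityMeasure P] (hY : M.IsSample θ₀ P Y)
    {g : Pattern k → ℝ}
    (hg : ∑ y, M.manifest θ₀ y * g y = 0) :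
    TendstoInDistribution (fun (N : ℕ) ω => (√N)⁻¹ * ∑ n ∈ Finset.range N, g (Y n ω)) atTop id
      (fun _ => P) (gaussianReal 0 (∑ y, M.manifest θ₀ y * g y ^ 2).toNNReal) := by
  have h0 : P[fun ω => g (Y 0 ω)] = 0 := (hY.integral_comp 0 g).trans hg
  have hv : Var[fun ω => g (Y 0 ω); P] = ∑ y, M.manifest θ₀ y * g y ^ 2 := by
    rw [variance_of_integral_eq_zero (hY.memLp_comp 0 g).aemeasurable h0]
    exact hY.integral_comp 0 fun y => g y ^ 2
  have h := tendstoInDistribution_inv_sqrt_mul_sum_sub (P := P)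
    (P' := gaussianReal 0 (Var[fun ω => g (Y 0 ω); P]).toNNReal)
    (X := fun n ω => g (Y n ω)) (Y := id) ⟨aemeasurable_id, Measure.map_id⟩ (hY.memLp_comp 0 g)
    (hY.iIndepFun_comp g) fun n => (hY.identDistrib n).comp .of_discrete
  rw [hv] at h
  simpa only [h0, mul_zero, sub_zero] using h

theorem integral_sq_empirical_sub_le [IsProbabilityMeasure P] (hY : M.IsSample θ₀ P Y) (N : ℕ)
    (y : Pattern k) :
    ∫ ω, N * (empirical Y N ω y - M.manifest θ₀ y) ^ 2 ∂P ≤ M.manifest θ₀ y := by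
  have hp : 0 ≤ M.manifest θ₀ y := by rw [← hY.law 0 y]; positivity
  rcases N.eq_zero_or_pos with rfl | hN
  · simpa using hp
  have hN' : (N : ℝ) ≠ 0 := by positivity
  set g : Pattern k → ℝ := Pi.single y 1 with hg
  set X : ℕ → Ω → ℝ := fun n ω => g (Y n ω) with hX
  have hmem : ∀ n, MemLp (X n) 2 P := fun n => hY.memLp_comp n g
  have hint : ∀ n, ∫ ω, X n ω ∂P = M.manifest θ₀ y := fun n => by
    rw [hX, hY.integral_comp n g]; simp [hg, Pi.single_apply]
  -- An indicator equals its square, so its second moment is its mean.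
  have hvar : ∀ n, Var[X n; P] ≤ M.manifest θ₀ y := fun n => by
    refine (variance_le_expectation_sq (hmem n).aestronglyMeasurable).trans_eq ?_
    rw [← hint n]
    refine integral_congr_ae (Eventually.of_forall fun ω => ?_)
    simp [hX, hg, Pi.single_apply]
  have hsum : Var[∑ n ∈ Finset.range N, X n; P] ≤ N * M.manifest θ₀ y := by
    rw [IndepFun.variance_sum (fun n _ => hmem n)
      fun i _ j _ hij => (hY.iIndepFun_comp g).indepFun hij]
    exact (Finset.sum_le_sum fun n _ => hvar n).trans_eq (by simp)
  have hmean : ∫ ω, (∑ n ∈ Finset.range N, X n) ω ∂P = N * M.manifest θ₀ y := by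
    simp only [Finset.sum_apply]
    rw [integral_finsetSum _ fun n _ => (hmem n).integrable one_le_two]
    simp [hint]
  have hae : AEMeasurable (∑ n ∈ Finset.range N, X n) P :=
    Finset.aemeasurable_sum _ fun n _ => (hmem n).aemeasurable
  rw [variance_eq_integral hae, hmean] at hsum
  have heq : ∀ ω, N * (empirical Y N ω y - M.manifest θ₀ y) ^ 2
      = (N : ℝ)⁻¹ * ((∑ n ∈ Finset.range N, X n) ω - N * M.manifest θ₀ y) ^ 2 := fun ω => by
    rw [empirical_apply, Finset.sum_apply]
    simp only [hX, hg]
    field_simp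
  simp only [heq]
  rw [integral_const_mul]
  calc _ ≤ (N : ℝ)⁻¹ * (N * M.manifest θ₀ y) := by gcongr
    _ = _ := by field_simp

/-- Chebyshev's inequality for the relative frequencies. -/
theorem measureReal_le_norm_empirical_sub [IsProbabilityMeasure P] [NeZero m]
    (hY : M.IsSample θ₀ P Y) (N : ℕ) {r : ℝ}
    (hr : 0 < r) :
    P.real {ω | r ≤ √N * ‖empirical Y N ω - M.manifest θ₀‖} ≤ (r ^ 2)⁻¹ := by
  have hsq : ∀ ω, (√N * ‖empirical Y N ω - M.manifest θ₀‖) ^ 2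
      = ∑ y, N * (empirical Y N ω y - M.manifest θ₀ y) ^ 2 := fun ω => by
    rw [mul_pow, Real.sq_sqrt (Nat.cast_nonneg N), EuclideanSpace.norm_sq_eq, Finset.mul_sum]
    simp
  have hbdd : ∀ y, Integrable (fun ω => (N : ℝ) * (empirical Y N ω y - M.manifest θ₀ y) ^ 2) P := by
    intro y
    have hmem : MemLp (fun ω => empirical Y N ω y - M.manifest θ₀ y) 2 P := by
      simp only [empirical_apply, div_eq_inv_mul]
      exact ((memLp_finsetSum _ fun n _ => hY.memLp_comp n _).const_mul _).sub (memLp_const _)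
    exact hmem.integrable_sq.const_mul _
  have h := mul_meas_ge_le_integral_of_nonneg (μ := P)
    (f := fun ω => (√N * ‖empirical Y N ω - M.manifest θ₀‖) ^ 2)
    (Eventually.of_forall fun ω => sq_nonneg _)
    (by simp only [hsq]; exact integrable_finsetSum _ fun y _ => hbdd y) (r ^ 2)
  have hle : ∫ ω, (√N * ‖empirical Y N ω - M.manifest θ₀‖) ^ 2 ∂P ≤ 1 := by
    simp only [hsq]
    rw [integral_finsetSum _ fun y _ => hbdd y, ← M.sum_manifest θ₀]
    exact Finset.sum_le_sum fun y _ => hY.integral_sq_empirical_sub_le N y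
  have hset : {ω | r ^ 2 ≤ (√N * ‖empirical Y N ω - M.manifest θ₀‖) ^ 2}
      = {ω | r ≤ √N * ‖empirical Y N ω - M.manifest θ₀‖} := by
    ext ω
    exact pow_le_pow_iff_left₀ hr.le (by positivity) two_ne_zero
  rw [hset] at h
  rw [← one_div, le_div_iff₀ (by positivity), mul_comm]
  exact h.trans hle

/-- Central limit theorem for the projection of the relative frequencies. -/
theorem tendstoInDistribution_projMatrix [IsProbabilityMeasure P] [NeZero m]
    (hY : M.IsSample θ₀ P Y)
    (hpos : ∀ y, 0 < M.manifest θ₀ y) (hd : DifferentiableAt ℝ M.manifest θ₀)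
    (hrank : (M.jacobian θ₀).rank = t + u) :
    TendstoInDistribution
      (fun (N : ℕ) ω => √(N : ℝ) • Matrix.toEuclideanCLM (𝕜 := ℝ) (M.projMatrix θ₀)
        (empirical Y N ω - M.manifest θ₀))
      atTop id (fun _ => P)
      (multivariateGaussian 0
        (M.jacobian θ₀ * ((M.scaledJacobian θ₀)ᵀ * M.scaledJacobian θ₀)⁻¹ *
          (M.jacobian θ₀)ᵀ)) := by
  have hmeas : ∀ N : ℕ, Measurable fun ω => √(N : ℝ) •
      Matrix.toEuclideanCLM (𝕜 := ℝ) (M.projMatrix θ₀) (empirical Y N ω - M.manifest θ₀) :=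
    fun N => ((ContinuousLinearMap.measurable (Matrix.toEuclideanCLM (𝕜 := ℝ)
      (M.projMatrix θ₀))).comp ((measurable_empirical hY.measurable N).sub_const _)).fun_const_smul _
  refine ⟨fun N => (hmeas N).aemeasurable, aemeasurable_id, ?_⟩
  -- Cramér–Wold argument: the characteristic function at `x` is that of the scalar sum of `g (Y
  -- n)`, with `g = Πᵀ x`, at `1`.
  refine ProbabilityMeasure.tendsto_iff_tendsto_charFun.2 fun x => ?_
  set g : Pattern k → ℝ := (M.projMatrix θ₀)ᵀ *ᵥ x.ofLp with hg
  have hg0 : ∑ y, M.manifest θ₀ y * g y = 0 := by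
    change (M.manifest θ₀).ofLp ⬝ᵥ g = 0
    rw [hg, Matrix.mulVec_transpose, dotProduct_comm, ← Matrix.dotProduct_mulVec,
      projMatrix_mulVec_manifest hpos hd, dotProduct_zero]
  have hclt := ProbabilityMeasure.tendsto_iff_tendsto_charFun.1
    (hY.tendstoInDistribution_sum hg0).tendsto 1
  have hlin : ∀ (N : ℕ) ω, inner ℝ (√(N : ℝ) • Matrix.toEuclideanCLM (𝕜 := ℝ) (M.projMatrix θ₀)
      (empirical Y N ω - M.manifest θ₀)) x = (√N)⁻¹ * ∑ n ∈ Finset.range N, g (Y n ω) := by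
    intro N ω
    have h1 : inner ℝ (Matrix.toEuclideanCLM (𝕜 := ℝ) (M.projMatrix θ₀)
        (empirical Y N ω - M.manifest θ₀)) x = ∑ y, g y * empirical Y N ω y := by
      rw [real_inner_comm, Matrix.inner_toEuclideanCLM, Matrix.dotProduct_mulVec,
        ← Matrix.mulVec_transpose, ← hg, WithLp.ofLp_sub, dotProduct_sub,
        dotProduct_comm g (M.manifest θ₀).ofLp]
      rw [show (M.manifest θ₀).ofLp ⬝ᵥ g = 0 from hg0, sub_zero]
      rfl
    rw [real_inner_smul_left, h1, sum_mul_empirical, mul_div_assoc', mul_div_right_comm,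
      Real.sqrt_div_self']
    simp
  have hvar : x.ofLp ⬝ᵥ (M.jacobian θ₀ * ((M.scaledJacobian θ₀)ᵀ * M.scaledJacobian θ₀)⁻¹ *
      (M.jacobian θ₀)ᵀ) *ᵥ x.ofLp = ∑ y, M.manifest θ₀ y * g y ^ 2 := by
    rw [← projMatrix_mul_diagonal_mul_transpose hpos hrank, ← Matrix.mulVec_mulVec, ← hg,
      ← Matrix.mulVec_mulVec, Matrix.dotProduct_mulVec, ← Matrix.mulVec_transpose, ← hg, dotProduct]
    refine Finset.sum_congr rfl fun y _ => ?_
    rw [Matrix.mulVec_diagonal]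
    ring
  have hnn : 0 ≤ ∑ y, M.manifest θ₀ y * g y ^ 2 :=
    Finset.sum_nonneg fun y _ => mul_nonneg (hpos y).le (sq_nonneg _)
  simp only [ProbabilityMeasure.coe_mk] at hclt ⊢
  simp only [Measure.map_id, charFun_gaussianReal, charFun_multivariateGaussian
    posSemidef_covariance, hvar] at hclt ⊢
  convert hclt using 1
  · ext N
    rw [charFun_apply, charFun_apply, integral_map (hmeas N).aemeasurable (by fun_prop),
      integral_map ((hY.tendstoInDistribution_sum hg0).forall_aemeasurable N) (by fun_prop)]
    simp only [hlin]
    simp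
  · congr 2
    simp [Real.coe_toNNReal _ hnn]

end Model.IsSample

/-! ### Negligibility of the remainder in probability. -/

namespace Model

variable {k m t u : ℕ} {M : Model k m t u} {Θ : Set (Param t u)} {θ₀ : Param t u} {φ : ℝ → ℝ}

/-- The bound is uniform over all minimizers, so it applies pointwise to any estimator, however it
selects one. -/
theorem eventually_norm_manifest_minimizer_le [NeZero m] (hθ₀ : θ₀ ∈ interior Θ)
    (hB : M.Birch Θ θ₀) (hφ : IsDivergenceFunction φ) (hs : ContDiffOn ℝ 2 φ (Set.Ioi 0))
    (hne : iteratedDeriv 2 φ 1 ≠ 0) {c : ℝ} (hc : 0 < c) :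
    ∃ δ > 0, ∀ a, ‖a - M.manifest θ₀‖ < δ → ∑ y, a y = 1 →
      (M.argminPhi φ Θ a).Nonempty ∧ ∀ θ ∈ M.argminPhi φ Θ a,
        ‖M.manifest θ - M.manifest θ₀
          - Matrix.toEuclideanCLM (𝕜 := ℝ) (M.projMatrix θ₀) (a - M.manifest θ₀)‖
          ≤ c * ‖a - M.manifest θ₀‖ := by
  have h1 := (manifest_minimizer_isLittleO hθ₀ hB hφ hs hne).def hc
  rw [minimizerFilter, eventually_inf_principal, eventually_comap] at h1
  obtain ⟨δ, hδ, h⟩ := Metric.eventually_nhds_iff.1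
    (h1.and (eventually_nonempty_argminPhi hθ₀ hB hφ hs hne))
  refine ⟨δ, hδ, fun a ha ha1 => ?_⟩
  obtain ⟨h2, h3⟩ := h (y := a) (by rwa [dist_eq_norm])
  exact ⟨h3 ha1, fun θ hθ => h2 (a, θ) rfl ⟨ha1, hθ⟩⟩

theorem IsMinPhiEstimator.tendstoInMeasure_sub [NeZero m] (hθ₀ : θ₀ ∈ interior Θ)
    (hB : M.Birch Θ θ₀) (hφ : IsDivergenceFunction φ) (hs : ContDiffOn ℝ 2 φ (Set.Ioi 0))
    (hne : iteratedDeriv 2 φ 1 ≠ 0) {Ω : Type*} [MeasurableSpace Ω] {P : Measure Ω}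
    [IsProbabilityMeasure P] {Y : ℕ → Ω → Pattern k} (hY : M.IsSample θ₀ P Y)
    {est : ℕ → Ω → Param t u} (hest : M.IsMinPhiEstimator φ Θ P Y est) :
    TendstoInMeasure P
      ((fun (N : ℕ) (ω : Ω) => √(N : ℝ) • (M.manifest (est N ω) - M.manifest θ₀))
        - fun (N : ℕ) ω => √(N : ℝ) • Matrix.toEuclideanCLM (𝕜 := ℝ) (M.projMatrix θ₀)
          (empirical Y N ω - M.manifest θ₀)) atTop 0 := by
  rw [tendstoInMeasure_iff_measureReal_norm]
  intro ε hε
  rw [Metric.tendsto_nhds]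
  intro τ hτ
  -- With slope `c`, a remainder of size `ε` needs `√N ‖p̂ - p₀‖ ≥ ε / c`, which Chebyshev bounds by
  -- `(c / ε) ^ 2`. So `c` is fixed before `δ`, and `N` is taken large afterwards.
  obtain ⟨c, hc, hcτ⟩ : ∃ c > 0, ((ε / c) ^ 2)⁻¹ < τ / 2 := by
    have h : Tendsto (fun c : ℝ => ((ε / c) ^ 2)⁻¹) (𝓝[>] 0) (𝓝 0) := by
      have h2 : Tendsto (fun c : ℝ => (c / ε) ^ 2) (𝓝[>] 0) (𝓝 0) := by
        have : Continuous fun c : ℝ => (c / ε) ^ 2 := by fun_prop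
        simpa using (this.tendsto 0).mono_left nhdsWithin_le_nhds
      refine h2.congr fun c => ?_
      rw [← inv_pow, inv_div]
    obtain ⟨c, h1, h2⟩ := ((h.eventually (gt_mem_nhds (half_pos hτ))).and
      self_mem_nhdsWithin).exists
    exact ⟨c, h2, h1⟩
  obtain ⟨δ, hδ, hδc⟩ := eventually_norm_manifest_minimizer_le hθ₀ hB hφ hs hne hc
  have hN : ∀ᶠ N : ℕ in atTop, ((√(N : ℝ) * δ) ^ 2)⁻¹ < τ / 2 := by
    have h : Tendsto (fun N : ℕ => ((√(N : ℝ) * δ) ^ 2)⁻¹) atTop (𝓝 0) :=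
      tendsto_inv_atTop_zero.comp ((tendsto_pow_atTop two_ne_zero).comp
        ((Real.tendsto_sqrt_atTop.comp tendsto_natCast_atTop_atTop).atTop_mul_const hδ))
    exact h.eventually (gt_mem_nhds (half_pos hτ))
  filter_upwards [hN, eventually_gt_atTop 0] with N hNτ hN0
  rw [Real.dist_eq, sub_zero, abs_of_nonneg measureReal_nonneg]
  have hsqrt : 0 < √(N : ℝ) := Real.sqrt_pos.2 (by exact_mod_cast hN0)
  have hsub : {ω | ε ≤ ‖((fun (N : ℕ) (ω : Ω) =>
        √(N : ℝ) • (M.manifest (est N ω) - M.manifest θ₀))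
        - fun (N : ℕ) ω => √(N : ℝ) • Matrix.toEuclideanCLM (𝕜 := ℝ) (M.projMatrix θ₀)
          (empirical Y N ω - M.manifest θ₀)) N ω - (0 : ℕ → Ω → PatternVec k) N ω‖} ≤ᵐ[P]
      ({ω | √N * δ ≤ √N * ‖empirical Y N ω - M.manifest θ₀‖}
        ∪ {ω | ε / c ≤ √N * ‖empirical Y N ω - M.manifest θ₀‖} : Set Ω) := by
    filter_upwards [hest.mem_argmin N hN0] with ω hω hmem
    have hmem : ε ≤ ‖√(N : ℝ) • (M.manifest (est N ω) - M.manifest θ₀)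
      - √(N : ℝ) • Matrix.toEuclideanCLM (𝕜 := ℝ) (M.projMatrix θ₀)
          (empirical Y N ω - M.manifest θ₀) - 0‖ := hmem
    rw [sub_zero, ← smul_sub, norm_smul, Real.norm_of_nonneg hsqrt.le] at hmem
    by_cases hlt : ‖empirical Y N ω - M.manifest θ₀‖ < δ
    · right
      obtain ⟨h1, h2⟩ := hδc _ hlt (sum_empirical Y hN0 ω)
      have h3 := mul_le_mul_of_nonneg_left (h2 _ (hω h1)) hsqrt.le
      change ε / c ≤ _
      rw [div_le_iff₀ hc]
      linarith
    · left
      exact mul_le_mul_of_nonneg_left (not_lt.1 hlt) hsqrt.le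
  calc P.real _ ≤ P.real _ := ENNReal.toReal_mono (measure_ne_top _ _) (measure_mono_ae hsub)
    _ ≤ _ := measureReal_union_le _ _
    _ ≤ ((√(N : ℝ) * δ) ^ 2)⁻¹ + ((ε / c) ^ 2)⁻¹ :=
      add_le_add (hY.measureReal_le_norm_empirical_sub N (mul_pos hsqrt hδ))
        (hY.measureReal_le_norm_empirical_sub N (div_pos hε hc))
    _ < τ := by linarith

end Model

end LatentClass

end

theorem theorem3 {k m t u : ℕ} (M : LatentClass.Model k m t u)
    (Θ : Set (LatentClass.Param t u)) (θ₀ : LatentClass.Param t u) (hθ₀ : θ₀ ∈ interior Θ)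
    (hBirch : M.Birch Θ θ₀)
    (φ : ℝ → ℝ) (hφ : LatentClass.IsDivergenceFunction φ)
    (hφ_smooth : ContDiffOn ℝ 2 φ (Set.Ioi 0)) (hφ_one : iteratedDeriv 2 φ 1 ≠ 0)
    {Ω : Type*} [MeasurableSpace Ω] (P : Measure Ω) [IsProbabilityMeasure P]
    (Y : ℕ → Ω → LatentClass.Pattern k) (hY : M.IsSample θ₀ P Y)
    (est : ℕ → Ω → LatentClass.Param t u) (hest : M.IsMinPhiEstimator φ Θ P Y est) :
    TendstoInDistribution
      (fun (N : ℕ) (ω : Ω) => √(N : ℝ) • (M.manifest (est N ω) - M.manifest θ₀))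
      atTop id (fun _ => P)
      (multivariateGaussian 0
        (M.jacobian θ₀ * ((M.scaledJacobian θ₀)ᵀ * M.scaledJacobian θ₀)⁻¹ *
          (M.jacobian θ₀)ᵀ)) := by
  -- With no classes the manifest probabilities would all be `0`.
  have : NeZero m := M.neZero_of_pos (hBirch.pos fun _ => true)
  refine tendstoInDistribution_of_tendstoInMeasure_sub _ _
    (hY.tendstoInDistribution_projMatrix hBirch.pos hBirch.diff hBirch.rank_eq)
    (hest.tendstoInMeasure_sub hθ₀ hBirch hφ hφ_smooth hφ_one hY) fun N => ?_
  exact ((M.continuous_manifest.measurable.comp_aemeasurable (hest.aemeasurable N)).sub_const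
    _).fun_const_smul (√(N : ℝ))
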